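/- Let $\mathfrak A^{CAR}$ be the CAR algebra over $\mathbb Z$, i.e. the unital $C^*$-algebra generated by elements $c_j$ ($j\in\mathbb Z$) with $\{c_j,c_k\}=0$ and $\{c_j,c_k^*\}=\delta_{jk}1$; let $\Theta$ be its automorphism with $\Theta(c_j)=-c_j$, and for $\Lambda\subset\mathbb Z$ let $\mathfrak A^{CAR}_\Lambda$ be the $C^*$-subalgebra generated by the $c_j$ with $j\in\Lambda$. Let $\mathfrak A=\overline{\bigotimes_{\mathbb Z}M_2(\mathbb C)}^{C^*}$ be the spin-$\tfrac12$ (UHF) algebra, $\Theta$ its automorphism with $\Theta(\sigma_x^{(j)})=-\sigma_x^{(j)}$, $\Theta(\sigma_y^{(j)})=-\sigma_y^{(j)}$, $\Theta(\sigma_z^{(j)})=\sigma_z^{(j)}$ for all $j$, and $\mathfrak A_\Lambda$ the $C^*$-subalgebra generated by the $Q^{(j)}$ with $j\in\Lambda$, $Q\in M_2(\mathbb C)$ (where $Q^{(j)}$ is $Q$ at site $j$). In both cases a subscript $+$ on an algebra denotes its subalgebra of $\Theta$-fixed elements, and a subscript $+$ on a state its restriction to the $\Theta$-fixed subalgebra;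 $(\pi_\omega,\Omega_\omega,\mathfrak H_\omega)$ is the GNS triple of a state $\omega$, $\Lambda^c=\mathbb Z\setminus\Lambda$, and $'$, $''$ denote commutant and double commutant. (i) Let $\psi$ be a $\Theta$-invariant pure state of $\mathfrak A^{CAR}$ and $\Lambda\subset\mathbb Z$. Let $\Gamma$ be the self-adjoint unitary on $\mathfrak H_\psi$ with $\Gamma\pi_\psi(Q)\Gamma^{-1}=\pi_\psi(\Theta(Q))$ and $\Gamma\Omega_\psi=\Omega_\psi$, and let $\overline\pi_\psi$ be the representation of $\mathfrak A^{CAR}$ on $\mathfrak H_\psi$ with $\overline\pi_\psi(c_j)=\pi_\psi(c_j)\Gamma$, $\overline\pi_\psi(c_j^*)=\Gamma\pi_\psi(c_j^*)$. Then twisted Haag duality for $\Lambda$, $$\pi_\psi(\mathfrak A^{CAR}_\Lambda)''=\overline\pi_\psi(\mathfrak A^{CAR}_{\Lambda^c})',$$ holds if and only if, on the GNS space $\mathfrak H_{\psi_+}$ of the state $\psi_+$ of $(\mathfrak A^{CAR})_+$, $$\pi_{\psi_+}((\mathfrak A^{CAR}_\Lambda)_+)''=\pi_{\psi_+}((\mathfrak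 A^{CAR}_{\Lambda^c})_+)'.$$ (ii) Let $\varphi$ be a $\Theta$-invariant pure state of $\mathfrak A$ and $\Lambda\subset\mathbb Z$. Then Haag duality for $\Lambda$, $\pi_\varphi(\mathfrak A_\Lambda)''=\pi_\varphi(\mathfrak A_{\Lambda^c})'$, holds if and only if, on the GNS space $\mathfrak H_{\varphi_+}$ of the state $\varphi_+$ of $(\mathfrak A)_+$, $$\pi_{\varphi_+}((\mathfrak A_\Lambda)_+)''=\pi_{\varphi_+}((\mathfrak A_{\Lambda^c})_+)'.$$ -/

import Mathlib

open scoped ComplexOrder symmDiff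

noncomputable section

namespace TwistedDuality

/-! ### C⋆-subalgebras generated by a set -/

/-- The unital C⋆-subalgebra generated by a set. -/
def cstarGen {B : Type*} [CStarAlgebra B] (s : Set B) : StarSubalgebra ℂ B :=
  (StarAlgebra.adjoin ℂ s).topologicalClosure

lemma isClosed_cstarGen {B : Type*} [CStarAlgebra B] (s : Set B) :
    IsClosed (cstarGen s : Set B) :=
  StarSubalgebra.isClosed_topologicalClosure _

lemma subset_cstarGen {B : Type*} [CStarAlgebra B] (s : Set B) : s ⊆ cstarGen s :=
  (StarAlgebra.subset_adjoin ℂ s).trans (StarSubalgebra.le_topologicalClosure _)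

lemma map_mem_cstarGen {B : Type*} [CStarAlgebra B] (s : Set B) (φ : B →⋆ₐ[ℂ] B)
    (hφ : Continuous φ) (h : ∀ x ∈ s, φ x ∈ cstarGen s) {x : B} (hx : x ∈ cstarGen s) :
    φ x ∈ cstarGen s := by
  have h1 : cstarGen s ≤ (cstarGen s).comap φ :=
    StarSubalgebra.topologicalClosure_minimal (StarAlgebra.adjoin_le h)
      ((isClosed_cstarGen s).preimage hφ)
  exact h1 hx

/-- The restriction to the C⋆-subalgebra generated by `s` of a continuous ⋆-homomorphism
that maps the generators into this subalgebra. -/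
def restrictGen {B : Type*} [CStarAlgebra B] (s : Set B) (φ : B →⋆ₐ[ℂ] B)
    (hφ : Continuous φ) (h : ∀ x ∈ s, φ x ∈ cstarGen s) : cstarGen s →⋆ₐ[ℂ] cstarGen s :=
  (φ.comp (cstarGen s).subtype).codRestrict (cstarGen s)
    fun x => map_mem_cstarGen s φ hφ h x.2

/-- Conjugation `x ↦ u x u⋆` by a unitary. -/
def conjHom {B : Type*} [CStarAlgebra B] (u : unitary B) : B →⋆ₐ[ℂ] B :=
  (Unitary.conjStarAlgAut ℂ B u : B →⋆ₐ[ℂ] B)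

lemma conjHom_apply {B : Type*} [CStarAlgebra B] (u : unitary B) (x : B) :
    conjHom u x = u * x * star (u : B) := rfl

/-! ### The Hilbert space on which both algebras are realised

Both the CAR algebra over `ℤ` and the UHF algebra `⨂_ℤ M₂(ℂ)` are simple, so each of them is the
norm closure of the ⋆-algebra generated by any realisation of its generators by bounded
operators. They are realised on the Hilbert space with orthonormal basis the finite subsets of
`ℤ` (the set of occupied sites, respectively of sites with spin up). -/

/-- The Hilbert space `ℓ²` over the finite subsets of `ℤ`. -/
abbrev Fock : Type := lp (fun _ : Finset ℤ => ℂ) 2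

lemma weighted_summable (w : Finset ℤ → ℂ) (hw : ∀ G, ‖w G‖ ≤ 1) (e : Equiv.Perm (Finset ℤ))
    (ξ : Fock) : Summable fun G => ‖w G * ξ (e G)‖ ^ (2 : ENNReal).toReal := by
  have h0 : Summable fun G => ‖ξ (e G)‖ ^ (2 : ENNReal).toReal :=
    ((lp.memℓp ξ).summable (by simp)).comp_injective e.injective
  refine Summable.of_nonneg_of_le (fun G => by positivity) (fun G => ?_) h0
  gcongr
  rw [norm_mul]
  exact mul_le_of_le_one_left (norm_nonneg _) (hw G)

/-- The bounded operator `(T ξ)(G) = w(G) ξ(e(G))`, for a weight bounded by `1` and a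
permutation `e` of the finite subsets of `ℤ`. -/
def weighted (w : Finset ℤ → ℂ) (hw : ∀ G, ‖w G‖ ≤ 1) (e : Equiv.Perm (Finset ℤ)) :
    Fock →L[ℂ] Fock :=
  LinearMap.mkContinuous
    { toFun := fun ξ => ⟨fun G => w G * ξ (e G), memℓp_gen (weighted_summable w hw e ξ)⟩
      map_add' := fun ξ η => by
        ext G
        exact mul_add _ _ _
      map_smul' := fun a ξ => by
        ext G
        simp [mul_left_comm] }
    1 fun ξ => by
      rw [one_mul]
      refine lp.norm_le_of_tsum_le (by simp) (norm_nonneg _) ?_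
      rw [lp.norm_rpow_eq_tsum (by simp) ξ,
        ← e.tsum_eq fun G => ‖ξ G‖ ^ (2 : ENNReal).toReal]
      refine (weighted_summable w hw e ξ).tsum_le_tsum (fun G => ?_)
        (((lp.memℓp ξ).summable (by simp)).comp_injective e.injective)
      change ‖w G * ξ (e G)‖ ^ _ ≤ _
      gcongr
      rw [norm_mul]
      exact mul_le_of_le_one_left (norm_nonneg _) (hw G)

@[simp]
lemma weighted_apply (w : Finset ℤ → ℂ) (hw : ∀ G, ‖w G‖ ≤ 1) (e : Equiv.Perm (Finset ℤ))
    (ξ : Fock) (G : Finset ℤ) : weighted w hw e ξ G = w G * ξ (e G) := rfl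

lemma weighted_star (w : Finset ℤ → ℂ) (hw : ∀ G, ‖w G‖ ≤ 1) (e : Equiv.Perm (Finset ℤ)) :
    star (weighted w hw e) =
      weighted (fun G => star (w (e.symm G))) (fun G => by simpa using hw _) e.symm := by
  symm
  rw [ContinuousLinearMap.star_eq_adjoint, ContinuousLinearMap.eq_adjoint_iff]
  intro ξ η
  rw [lp.inner_eq_tsum, lp.inner_eq_tsum, ← e.tsum_eq]
  refine tsum_congr fun G => ?_
  simp
  ring

lemma fock_add_apply (ξ η : Fock) (G : Finset ℤ) : (ξ + η) G = ξ G + η G := rfl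

lemma fock_smul_apply (a : ℂ) (ξ : Fock) (G : Finset ℤ) : (a • ξ) G = a * ξ G := rfl

/-- Flipping the occupation of the site `j`. -/
def toggle (j : ℤ) : Equiv.Perm (Finset ℤ) :=
  Function.Involutive.toPerm (fun G => G ∆ {j}) fun _ => symmDiff_symmDiff_cancel_right _ _

@[simp]
lemma toggle_apply (j : ℤ) (G : Finset ℤ) : toggle j G = G ∆ {j} := rfl

@[simp]
lemma toggle_symm (j : ℤ) : (toggle j).symm = toggle j := rfl

lemma neg_one_pow_card_toggle (j : ℤ) (G : Finset ℤ) :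
    (-1 : ℂ) ^ (G ∆ {j}).card = -(-1) ^ G.card := by
  by_cases hj : j ∈ G
  · have h1 : G ∆ {j} = G.erase j := by
      ext x; simp only [Finset.mem_symmDiff, Finset.mem_singleton, Finset.mem_erase]; grind
    rw [h1, ← Finset.card_erase_add_one hj, pow_succ]; ring
  · have h1 : G ∆ {j} = insert j G := by
      ext x; simp only [Finset.mem_symmDiff, Finset.mem_singleton, Finset.mem_insert]; grind
    rw [h1, Finset.card_insert_of_notMem hj, pow_succ]; ring

/-- The unitary `e ^ (i t N)`, where `N` is the number of elements of the subset. -/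
def gaugeUnitary (t : ℝ) : unitary (Fock →L[ℂ] Fock) :=
  ⟨weighted (fun G => (Circle.exp t : ℂ) ^ G.card) (fun G => by simp [norm_pow]) 1, by
    have h (G : Finset ℤ) :
        (starRingEnd ℂ) (Circle.exp t : ℂ) ^ G.card * (Circle.exp t : ℂ) ^ G.card = 1 := by
      rw [← mul_pow, mul_comm, Complex.mul_conj, Circle.normSq_coe]; simp
    have h' (G : Finset ℤ) :
        (Circle.exp t : ℂ) ^ G.card * (starRingEnd ℂ) (Circle.exp t : ℂ) ^ G.card = 1 := by
      rw [mul_comm, h]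
    constructor
    · rw [weighted_star]
      ext ξ G
      change (starRingEnd ℂ) ((Circle.exp t : ℂ) ^ G.card) *
        ((Circle.exp t : ℂ) ^ G.card * ξ G) = ξ G
      rw [← mul_assoc, map_pow, h, one_mul]
    · rw [weighted_star]
      ext ξ G
      change (Circle.exp t : ℂ) ^ G.card *
        ((starRingEnd ℂ) ((Circle.exp t : ℂ) ^ G.card) * ξ G) = ξ G
      rw [← mul_assoc, map_pow, h', one_mul]⟩

/-- Conjugation by `e ^ (i t N)`. -/
def gaugeConj (t : ℝ) : (Fock →L[ℂ] Fock) →⋆ₐ[ℂ] (Fock →L[ℂ] Fock) :=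
  conjHom (gaugeUnitary t)

lemma continuous_gaugeConj (t : ℝ) : Continuous (gaugeConj t) := by
  change Continuous fun x => (gaugeUnitary t : Fock →L[ℂ] Fock) * x *
    star (gaugeUnitary t : Fock →L[ℂ] Fock)
  fun_prop

lemma gaugeConj_apply (t : ℝ) (x : Fock →L[ℂ] Fock) :
    gaugeConj t x = (gaugeUnitary t : Fock →L[ℂ] Fock) * x *
      star (gaugeUnitary t : Fock →L[ℂ] Fock) := rfl

lemma gaugeConj_weighted (t : ℝ) (w : Finset ℤ → ℂ) (hw : ∀ G, ‖w G‖ ≤ 1)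
    (e : Equiv.Perm (Finset ℤ)) (ξ : Fock) (G : Finset ℤ) :
    gaugeConj t (weighted w hw e) ξ G =
      (Circle.exp t : ℂ) ^ G.card *
        (w G * ((starRingEnd ℂ) (Circle.exp t : ℂ) ^ (e G).card * ξ (e G))) := by
  have hs : star (gaugeUnitary t : Fock →L[ℂ] Fock) =
      weighted (fun G => star ((Circle.exp t : ℂ) ^ G.card)) (fun G => by simp [norm_pow]) 1 :=
    weighted_star (fun G => (Circle.exp t : ℂ) ^ G.card) (fun G => by simp [norm_pow]) 1
  rw [gaugeConj_apply, hs, ← map_pow]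
  rfl

lemma gaugeConj_pi_pi (x : Fock →L[ℂ] Fock) : gaugeConj Real.pi (gaugeConj Real.pi x) = x := by
  have h1 : (gaugeUnitary Real.pi : Fock →L[ℂ] Fock) * gaugeUnitary Real.pi = 1 := by
    ext ξ G
    change (Circle.exp Real.pi : ℂ) ^ G.card * ((Circle.exp Real.pi : ℂ) ^ G.card * ξ G) = ξ G
    rw [← mul_assoc, ← mul_pow]
    simp
  rw [gaugeConj_apply, gaugeConj_apply]
  have h2 := congrArg star h1
  rw [star_mul, star_one] at h2
  calc _ = ((gaugeUnitary Real.pi : Fock →L[ℂ] Fock) * gaugeUnitary Real.pi) * x *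
        (star (gaugeUnitary Real.pi : Fock →L[ℂ] Fock) *
          star (gaugeUnitary Real.pi : Fock →L[ℂ] Fock)) := by simp only [mul_assoc]
    _ = x := by rw [h1, h2, one_mul, mul_one]

/-! ### The CAR algebra over `ℤ` -/

/-- The sign `(-1) ^ #{k ∈ G | k < j}`. -/
def fermiSign (j : ℤ) (G : Finset ℤ) : ℂ := (-1) ^ (G.filter (· < j)).card

lemma fermiSign_toggle (j k : ℤ) (G : Finset ℤ) :
    fermiSign k (G ∆ {j}) = (if j < k then -1 else 1) * fermiSign k G := by
  unfold fermiSign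
  split_ifs with h
  · have h1 : (G ∆ {j}).filter (· < k) = (G.filter (· < k)) ∆ {j} := by
      ext x; simp only [Finset.mem_symmDiff, Finset.mem_singleton, Finset.mem_filter]; grind
    rw [h1, neg_one_pow_card_toggle]; ring
  · have h1 : (G ∆ {j}).filter (· < k) = G.filter (· < k) := by
      ext x; simp only [Finset.mem_symmDiff, Finset.mem_singleton, Finset.mem_filter]; grind
    rw [h1, one_mul]

lemma fermiSign_mul_self (j : ℤ) (G : Finset ℤ) : fermiSign j G * fermiSign j G = 1 := by
  rw [fermiSign, ← mul_pow]; simp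

lemma star_fermiSign (j : ℤ) (G : Finset ℤ) :
    (starRingEnd ℂ) (fermiSign j G) = fermiSign j G := by
  simp [fermiSign]

/-- The annihilation operator at the site `j` on the Fock space. -/
def annihilate (j : ℤ) : Fock →L[ℂ] Fock :=
  weighted (fun G => if j ∈ G then 0 else fermiSign j G)
    (fun G => by split_ifs <;> simp [fermiSign]) (toggle j)

lemma gaugeConj_annihilate (t : ℝ) (j : ℤ) :
    gaugeConj t (annihilate j) = (starRingEnd ℂ) (Circle.exp t : ℂ) • annihilate j := by
  ext ξ G
  rw [annihilate, gaugeConj_weighted]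
  have h : (Circle.exp t : ℂ) ^ G.card * (starRingEnd ℂ) (Circle.exp t : ℂ) ^ G.card = 1 := by
    rw [← mul_pow, Complex.mul_conj, Circle.normSq_coe]; simp
  by_cases hj : j ∈ G
  · simp [hj]
  · have hc : (toggle j G).card = G.card + 1 := by
      have hd : Disjoint G {j} := by simpa using hj
      rw [toggle_apply, hd.symmDiff_eq_sup, Finset.sup_eq_union,
        Finset.card_union_of_disjoint hd, Finset.card_singleton]
    rw [hc, pow_succ]
    simp only [hj, if_false, smul_apply, lp.coeFn_smul, Pi.smul_apply,
      weighted_apply, smul_eq_mul]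
    linear_combination (fermiSign j G * (starRingEnd ℂ) (Circle.exp t : ℂ) * ξ (toggle j G)) * h

/-- The CAR algebra over `ℤ`: the C⋆-algebra generated by the annihilation operators. -/
def CAR : Type := cstarGen (Set.range annihilate)

namespace CAR

instance : CStarAlgebra CAR :=
  haveI := isClosed_cstarGen (Set.range annihilate)
  inferInstanceAs (CStarAlgebra (cstarGen (Set.range annihilate)))

instance : PartialOrder CAR := CStarAlgebra.spectralOrder CAR

instance : StarOrderedRing CAR := CStarAlgebra.spectralOrderedRing CAR

/-- The generator `c_j`. -/
def c (j : ℤ) : CAR := ⟨annihilate j, subset_cstarGen _ ⟨j, rfl⟩⟩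

/-- The gauge automorphism `γ_t`, with `γ_t(c_j) = e^{-it} c_j`. -/
def gauge (t : ℝ) : CAR →⋆ₐ[ℂ] CAR :=
  restrictGen (Set.range annihilate) (gaugeConj t) (continuous_gaugeConj t) (by
    rintro _ ⟨j, rfl⟩
    rw [gaugeConj_annihilate]
    exact SMulMemClass.smul_mem _ (subset_cstarGen _ ⟨j, rfl⟩))

lemma gauge_c (t : ℝ) (j : ℤ) : gauge t (c j) = (starRingEnd ℂ) (Circle.exp t : ℂ) • c j :=
  Subtype.ext (gaugeConj_annihilate t j)

/-- The parity automorphism `Θ`, with `Θ(c_j) = -c_j`. -/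
def Θ : CAR →⋆ₐ[ℂ] CAR := gauge Real.pi

lemma Θ_c (j : ℤ) : Θ (c j) = -c j := by
  rw [Θ, gauge_c]; simp

/-- The C⋆-subalgebra `𝔄^{CAR}_Λ` generated by the `c_j` with `j ∈ Λ`. -/
def localAlg (Λ : Set ℤ) : StarSubalgebra ℂ CAR := cstarGen (c '' Λ)

/-- The canonical anticommutation relations `{c_j, c_k} = 0`. -/
lemma c_anticomm (j k : ℤ) : c j * c k + c k * c j = 0 := by
  refine Subtype.ext (ContinuousLinearMap.ext fun ξ => lp.ext (funext fun G => ?_))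
  change annihilate j (annihilate k ξ) G + annihilate k (annihilate j ξ) G = (0 : ℂ)
  simp only [annihilate, weighted_apply, toggle_apply, Finset.mem_symmDiff,
    Finset.mem_singleton, fermiSign_toggle]
  rcases eq_or_ne j k with rfl | hjk
  · by_cases hj : j ∈ G <;> simp [hj]
  · rw [symmDiff_right_comm]
    by_cases hj : j ∈ G <;> by_cases hk : k ∈ G <;> simp [hj, hk, hjk, hjk.symm]
    rcases lt_or_gt_of_ne hjk with h | h <;> simp [h, h.not_gt] <;> ring

/-- The canonical anticommutation relations `{c_j, c_k⋆} = δ_{jk}`. -/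
lemma c_anticomm_star (j k : ℤ) :
    c j * star (c k) + star (c k) * c j = if j = k then 1 else 0 := by
  have hs : star (annihilate k) =
      weighted (fun G => if k ∈ G ∆ {k} then 0 else fermiSign k (G ∆ {k}))
        (fun G => by split_ifs <;> simp [fermiSign]) (toggle k) := by
    rw [annihilate, weighted_star]
    congr 1
    ext G
    rw [toggle_symm, toggle_apply]
    split_ifs <;> simp [star_fermiSign]
  refine Subtype.ext (ContinuousLinearMap.ext fun ξ => lp.ext (funext fun G => ?_))
  have h0 : ((if j = k then (1 : CAR) else 0).1 ξ) G = if j = k then ξ G else 0 := by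
    split_ifs <;> rfl
  rw [h0]
  change annihilate j (star (annihilate k) ξ) G + star (annihilate k) (annihilate j ξ) G = _
  rw [hs]
  simp only [annihilate, weighted_apply, toggle_apply, Finset.mem_symmDiff,
    Finset.mem_singleton, fermiSign_toggle]
  rcases eq_or_ne j k with rfl | hjk
  · by_cases hj : j ∈ G <;> simp [hj, ← mul_assoc, fermiSign_mul_self]
  · rw [symmDiff_right_comm]
    by_cases hj : j ∈ G <;> by_cases hk : k ∈ G <;> simp [hj, hk, hjk, hjk.symm]
    rcases lt_or_gt_of_ne hjk with h | h <;> simp [h, h.not_gt] <;> ring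

end CAR

/-! ### The spin algebra `⨂_ℤ M₂(ℂ)` -/

/-- The matrix unit `e_{ab}` at the site `j`; index `0` is spin up (`j ∈ G`), `1` is spin down. -/
def siteUnit (j : ℤ) (a b : Fin 2) : Fock →L[ℂ] Fock :=
  weighted (fun G => if (if j ∈ G then 0 else 1) = a then 1 else 0)
    (fun G => by split_ifs <;> simp) (if a = b then 1 else toggle j)

/-- The operator `Q^{(j)}`: the matrix `Q` at the site `j` and the identity elsewhere. -/
def siteOp (j : ℤ) (Q : Matrix (Fin 2) (Fin 2) ℂ) : Fock →L[ℂ] Fock :=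
  ∑ a, ∑ b, Q a b • siteUnit j a b

lemma siteOp_apply (j : ℤ) (Q : Matrix (Fin 2) (Fin 2) ℂ) (ξ : Fock) (G : Finset ℤ) :
    siteOp j Q ξ G = if j ∈ G then Q 0 0 * ξ G + Q 0 1 * ξ (G ∆ {j})
      else Q 1 0 * ξ (G ∆ {j}) + Q 1 1 * ξ G := by
  simp only [siteOp, Fin.sum_univ_two, siteUnit, add_apply, smul_apply, fock_add_apply,
    fock_smul_apply, weighted_apply]
  by_cases hj : j ∈ G <;> simp [hj]

lemma gaugeConj_siteUnit (j : ℤ) (a b : Fin 2) :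
    gaugeConj Real.pi (siteUnit j a b) = (if a = b then (1 : ℂ) else -1) • siteUnit j a b := by
  ext ξ G
  rw [siteUnit, gaugeConj_weighted]
  have h (n : ℕ) : (-1 : ℂ) ^ n * (-1) ^ n = 1 := by rw [← mul_pow]; simp
  by_cases hab : a = b
  · simp [hab]
    split_ifs <;> simp [← mul_assoc, h]
  · have hc : (-1 : ℂ) ^ G.card * (-1) ^ (G ∆ {j}).card = -1 := by
      rw [neg_one_pow_card_toggle, mul_neg, h]
    simp [hab]
    split_ifs <;> simp [← mul_assoc, hc]

lemma gaugeConj_siteOp (j : ℤ) (Q : Matrix (Fin 2) (Fin 2) ℂ) :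
    gaugeConj Real.pi (siteOp j Q) =
      siteOp j (Matrix.of fun a b => (if a = b then 1 else -1) * Q a b) := by
  simp only [siteOp, map_sum, map_smul, gaugeConj_siteUnit, smul_smul, Matrix.of_apply, mul_comm]

/-- The C⋆-algebra of the spin chain: the UHF algebra generated by all `Q^{(j)}`. -/
def Spin : Type := cstarGen (Set.range fun x : ℤ × Matrix (Fin 2) (Fin 2) ℂ => siteOp x.1 x.2)

namespace Spin

instance : CStarAlgebra Spin :=
  haveI := isClosed_cstarGen
    (Set.range fun x : ℤ × Matrix (Fin 2) (Fin 2) ℂ => siteOp x.1 x.2)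
  inferInstanceAs (CStarAlgebra
    (cstarGen (Set.range fun x : ℤ × Matrix (Fin 2) (Fin 2) ℂ => siteOp x.1 x.2)))

instance : PartialOrder Spin := CStarAlgebra.spectralOrder Spin

instance : StarOrderedRing Spin := CStarAlgebra.spectralOrderedRing Spin

/-- The element `Q^{(j)}` of the spin algebra. -/
def site (j : ℤ) (Q : Matrix (Fin 2) (Fin 2) ℂ) : Spin :=
  ⟨siteOp j Q, subset_cstarGen _ ⟨(j, Q), rfl⟩⟩

lemma site_one (j : ℤ) : site j 1 = 1 := by
  refine Subtype.ext (ContinuousLinearMap.ext fun ξ => lp.ext (funext fun G => ?_))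
  change siteOp j 1 ξ G = ξ G
  by_cases hj : j ∈ G <;> simp [siteOp_apply, hj]

lemma site_mul (j : ℤ) (P Q : Matrix (Fin 2) (Fin 2) ℂ) :
    site j (P * Q) = site j P * site j Q := by
  refine Subtype.ext (ContinuousLinearMap.ext fun ξ => lp.ext (funext fun G => ?_))
  change siteOp j (P * Q) ξ G = siteOp j P (siteOp j Q ξ) G
  by_cases hj : j ∈ G <;>
    simp [siteOp_apply, hj, Matrix.mul_apply, Finset.mem_symmDiff] <;> ring

lemma site_star (j : ℤ) (Q : Matrix (Fin 2) (Fin 2) ℂ) :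
    site j (star Q) = star (site j Q) := by
  refine Subtype.ext ?_
  change siteOp j (star Q) = star (siteOp j Q)
  have hu (a b : Fin 2) : star (siteUnit j a b) = siteUnit j b a := by
    rw [siteUnit, weighted_star]
    refine ContinuousLinearMap.ext fun ξ => lp.ext (funext fun G => ?_)
    have h1 : (Equiv.symm 1 : Equiv.Perm (Finset ℤ)) G = G := rfl
    by_cases hj : j ∈ G <;> fin_cases a <;> fin_cases b <;>
      simp [siteUnit, hj, Finset.mem_symmDiff, h1]
  simp [siteOp, hu, Matrix.star_apply]
  abel

lemma site_commute {j k : ℤ} (hjk : j ≠ k) (P Q : Matrix (Fin 2) (Fin 2) ℂ) :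
    site j P * site k Q = site k Q * site j P := by
  refine Subtype.ext (ContinuousLinearMap.ext fun ξ => lp.ext (funext fun G => ?_))
  change siteOp j P (siteOp k Q ξ) G = siteOp k Q (siteOp j P ξ) G
  by_cases hj : j ∈ G <;> by_cases hk : k ∈ G <;>
    simp [siteOp_apply, hj, hk, hjk, hjk.symm, Finset.mem_symmDiff,
      symmDiff_right_comm G {k} {j}] <;> ring

/-- The automorphism `Θ` of the spin algebra: the infinite product of the `Ad σ_z^{(j)}`. -/
def Θ : Spin →⋆ₐ[ℂ] Spin :=
  restrictGen (Set.range fun x : ℤ × Matrix (Fin 2) (Fin 2) ℂ => siteOp x.1 x.2)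
    (gaugeConj Real.pi) (continuous_gaugeConj _) (by
      rintro _ ⟨⟨j, Q⟩, rfl⟩
      dsimp only
      rw [gaugeConj_siteOp]
      exact subset_cstarGen _ ⟨(j, _), rfl⟩)

/-- `Θ(σ_x) = -σ_x`, `Θ(σ_y) = -σ_y`, `Θ(σ_z) = σ_z` at every site. -/
lemma Θ_pauli (j : ℤ) :
    Θ (site j !![0, 1; 1, 0]) = -site j !![0, 1; 1, 0] ∧
    Θ (site j !![0, -Complex.I; Complex.I, 0]) = -site j !![0, -Complex.I; Complex.I, 0] ∧
    Θ (site j !![1, 0; 0, -1]) = site j !![1, 0; 0, -1] := by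
  refine ⟨Subtype.ext ?_, Subtype.ext ?_, Subtype.ext ?_⟩
  · refine (gaugeConj_siteOp j _).trans ?_
    change _ = -siteOp j _
    simp [siteOp]
    abel
  · refine (gaugeConj_siteOp j _).trans ?_
    change _ = -siteOp j _
    simp [siteOp]
    abel
  · refine (gaugeConj_siteOp j _).trans ?_
    change _ = siteOp j _
    simp [siteOp]

/-- The C⋆-subalgebra `𝔄_Λ` generated by the `Q^{(j)}` with `j ∈ Λ`. -/
def localAlg (Λ : Set ℤ) : StarSubalgebra ℂ Spin :=
  cstarGen {x | ∃ j ∈ Λ, ∃ Q, x = site j Q}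

end Spin

/-! ### States, even parts and GNS representations -/

section General

variable {A : Type*} [CStarAlgebra A] [PartialOrder A] [StarOrderedRing A]

/-- The states of a unital C⋆-algebra: normalised positive linear functionals. -/
def stateSpace (A : Type*) [CStarAlgebra A] : Set (A →ₗ[ℂ] ℂ) :=
  {f | (∀ a : A, 0 ≤ f (star a * a)) ∧ f 1 = 1}

/-- A pure state is an extreme point of the state space. -/
def IsPureState (ψ : A →ₚ[ℂ] ℂ) : Prop :=
  ψ.toLinearMap ∈ (stateSpace A).extremePoints ℝ

/-- The fixed-point subalgebra of `θ`. -/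
def evenSubalgebra (θ : A →⋆ₐ[ℂ] A) : StarSubalgebra ℂ A :=
  StarAlgHom.equalizer θ (StarAlgHom.id ℂ A)

/-- The C⋆-algebra `(𝔄)₊ = {Q | θ(Q) = Q}`. -/
def EvenPart (θ : A →⋆ₐ[ℂ] A) : Type _ := evenSubalgebra θ

namespace EvenPart

variable (θ : A →⋆ₐ[ℂ] A)

lemma isClosed : IsClosed (evenSubalgebra θ : Set A) :=
  isClosed_eq (map_continuous θ) continuous_id

instance : CStarAlgebra (EvenPart θ) :=
  haveI := isClosed θ
  inferInstanceAs (CStarAlgebra (evenSubalgebra θ))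

instance : PartialOrder (EvenPart θ) := CStarAlgebra.spectralOrder _

instance : StarOrderedRing (EvenPart θ) := CStarAlgebra.spectralOrderedRing _

/-- The inclusion of the even part. -/
def incl : EvenPart θ →⋆ₐ[ℂ] A := (evenSubalgebra θ).subtype

/-- The restriction `ψ₊` of a positive functional to the even part. -/
def restrict (ψ : A →ₚ[ℂ] ℂ) : EvenPart θ →ₚ[ℂ] ℂ :=
  PositiveLinearMap.mk₀ (ψ.toLinearMap ∘ₗ (incl θ).toAlgHom.toLinearMap) fun _ hx =>
    ψ.map_nonneg (map_nonneg (incl θ) hx)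

/-- The part of the even part that lies in the subalgebra `S`, that is `(𝔄)₊ ∩ S`. -/
def localPart (S : StarSubalgebra ℂ A) : Set (EvenPart θ) := incl θ ⁻¹' S

end EvenPart

variable (ψ : A →ₚ[ℂ] ℂ) (θ : A →⋆ₐ[ℂ] A) (h : ∀ a, ψ (θ a) = ψ a)

/-- The GNS vector. -/
def gnsVector : ψ.GNS := ((ψ.toPreGNS 1 : ψ.PreGNS) : ψ.GNS)

/-- The operator on the GNS space of a `θ`-invariant functional, which maps the vector of `a` to
the vector of `θ a`. -/
def parityOp : ψ.GNS →L[ℂ] ψ.GNS :=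
  ContinuousLinearMap.completion (LinearMap.mkContinuous
    (ψ.toPreGNS.toLinearMap ∘ₗ θ.toAlgHom.toLinearMap ∘ₗ ψ.ofPreGNS.toLinearMap) 1 fun x => by
      rw [one_mul, PositiveLinearMap.preGNS_norm_def, PositiveLinearMap.preGNS_norm_def]
      change √(ψ (star (θ (ψ.ofPreGNS x)) * θ (ψ.ofPreGNS x))).re ≤ _
      rw [← map_star, ← map_mul, h])

lemma parityOp_coe (a : A) :
    parityOp ψ θ h (ψ.toPreGNS a : ψ.PreGNS) = (ψ.toPreGNS (θ a) : ψ.PreGNS) :=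
  ContinuousLinearMap.completion_apply_coe _ _

lemma gns_coe (a b : A) :
    ψ.gnsStarAlgHom a (ψ.toPreGNS b : ψ.PreGNS) = (ψ.toPreGNS (a * b) : ψ.PreGNS) :=
  ContinuousLinearMap.completion_apply_coe _ _

lemma gns_ext {S T : ψ.GNS →L[ℂ] ψ.GNS}
    (hST : ∀ a : A, S (ψ.toPreGNS a : ψ.PreGNS) = T (ψ.toPreGNS a : ψ.PreGNS)) : S = T := by
  ext x
  induction x using UniformSpace.Completion.induction_on with
  | hp => exact isClosed_eq S.continuous T.continuous
  | ih x => exact hST x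

lemma parityOp_gnsVector : parityOp ψ θ h (gnsVector ψ) = gnsVector ψ := by
  rw [gnsVector, parityOp_coe, map_one]

lemma parityOp_mul_gns (a : A) :
    parityOp ψ θ h * ψ.gnsStarAlgHom a = ψ.gnsStarAlgHom (θ a) * parityOp ψ θ h := by
  refine gns_ext ψ fun b => ?_
  change parityOp ψ θ h (ψ.gnsStarAlgHom a _) = ψ.gnsStarAlgHom (θ a) (parityOp ψ θ h _)
  rw [gns_coe, parityOp_coe, parityOp_coe, gns_coe, map_mul]

lemma parityOp_mul_self (hθ : ∀ a, θ (θ a) = a) :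
    parityOp ψ θ h * parityOp ψ θ h = 1 := by
  refine gns_ext ψ fun b => ?_
  change parityOp ψ θ h (parityOp ψ θ h _) = _
  rw [parityOp_coe, parityOp_coe, hθ]; rfl

lemma star_parityOp (hθ : ∀ a, θ (θ a) = a) :
    star (parityOp ψ θ h) = parityOp ψ θ h := by
  symm
  rw [ContinuousLinearMap.star_eq_adjoint, ContinuousLinearMap.eq_adjoint_iff]
  intro x y
  induction x, y using UniformSpace.Completion.induction_on₂ with
  | hp => apply isClosed_eq <;> fun_prop
  | ih x y =>
    obtain ⟨x, rfl⟩ := ψ.toPreGNS.surjective x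
    obtain ⟨y, rfl⟩ := ψ.toPreGNS.surjective y
    rw [parityOp_coe, parityOp_coe, UniformSpace.Completion.inner_coe,
      UniformSpace.Completion.inner_coe, PositiveLinearMap.preGNS_inner_def,
      PositiveLinearMap.preGNS_inner_def, PositiveLinearMap.ofPreGNS_toPreGNS, ← h]
    simp only [map_mul, map_star, hθ, PositiveLinearMap.ofPreGNS_toPreGNS]

end General

/-! ### Haag duality and twisted Haag duality -/

namespace CAR

lemma Θ_Θ (a : CAR) : Θ (Θ a) = a :=
  Subtype.ext (gaugeConj_pi_pi _)

variable (ψ : CAR →ₚ[ℂ] ℂ) (h : ∀ a, ψ (Θ a) = ψ a)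

/-- The unitary `Γ` on the GNS space of a `Θ`-invariant state `ψ` that implements `Θ` and fixes
the GNS vector. -/
def Γ : ψ.GNS →L[ℂ] ψ.GNS := parityOp ψ Θ h

lemma Γ_mul_Γ : Γ ψ h * Γ ψ h = 1 := parityOp_mul_self ψ Θ h Θ_Θ

lemma star_Γ : star (Γ ψ h) = Γ ψ h := star_parityOp ψ Θ h Θ_Θ

lemma Γ_mul_gns (a : CAR) :
    Γ ψ h * ψ.gnsStarAlgHom a = ψ.gnsStarAlgHom (Θ a) * Γ ψ h := parityOp_mul_gns ψ Θ h a

lemma Γ_gnsVector : Γ ψ h (gnsVector ψ) = gnsVector ψ := parityOp_gnsVector ψ Θ h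

lemma inv_sqrt_two_mul : ((√2 : ℝ) : ℂ)⁻¹ * ((√2 : ℝ) : ℂ)⁻¹ * 2 = 1 := by
  rw [← mul_inv, ← Complex.ofReal_mul, Real.mul_self_sqrt (by norm_num)]; norm_num

/-- The operator `e^{iπΓ/4} = (1 + iΓ)/√2`. -/
def twistOp : ψ.GNS →L[ℂ] ψ.GNS := ((√2 : ℝ) : ℂ)⁻¹ • (1 + Complex.I • Γ ψ h)

lemma star_twistOp : star (twistOp ψ h) = ((√2 : ℝ) : ℂ)⁻¹ • (1 - Complex.I • Γ ψ h) := by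
  rw [twistOp, star_smul, star_add, star_smul, star_Γ]
  simp [sub_eq_add_neg]

/-- The operator `e^{iπΓ/4}` is unitary. -/
def twistUnitary : unitary (ψ.GNS →L[ℂ] ψ.GNS) :=
  ⟨twistOp ψ h, by
    have h3 : (1 - Complex.I • Γ ψ h) * (1 + Complex.I • Γ ψ h) = (2 : ℂ) • 1 := by
      simp only [sub_mul, mul_add, one_mul, mul_one, smul_mul_smul_comm, Γ_mul_Γ,
        Complex.I_mul_I]
      module
    have h4 : (1 + Complex.I • Γ ψ h) * (1 - Complex.I • Γ ψ h) = (2 : ℂ) • 1 := by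
      simp only [add_mul, mul_sub, one_mul, mul_one, smul_mul_smul_comm, Γ_mul_Γ,
        Complex.I_mul_I]
      module
    constructor
    · rw [star_twistOp, twistOp, smul_mul_smul_comm, h3, smul_smul, inv_sqrt_two_mul, one_smul]
    · rw [star_twistOp, twistOp, smul_mul_smul_comm, h4, smul_smul, inv_sqrt_two_mul, one_smul]⟩

/-- The twisted representation `π̄_ψ` of the CAR algebra on the GNS space of `ψ`. It is
characterised by its values on the generators, see `twistedRep_c` and `twistedRep_star_c`. -/
def twistedRep : CAR →⋆ₐ[ℂ] (ψ.GNS →L[ℂ] ψ.GNS) :=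
  (conjHom (twistUnitary ψ h)).comp (ψ.gnsStarAlgHom.comp (gauge (-(Real.pi / 2))))

lemma twistedRep_c (j : ℤ) : twistedRep ψ h (c j) = ψ.gnsStarAlgHom (c j) * Γ ψ h := by
  have hg : gauge (-(Real.pi / 2)) (c j) = Complex.I • c j := by
    rw [gauge_c, Circle.coe_exp, ← Complex.exp_conj]
    congr 1
    rw [← Complex.exp_pi_div_two_mul_I]
    congr 1
    simp [map_ofNat]
  have hc : Γ ψ h * ψ.gnsStarAlgHom (c j) = -(ψ.gnsStarAlgHom (c j) * Γ ψ h) := by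
    rw [Γ_mul_gns, Θ_c, map_neg, neg_mul]
  change twistOp ψ h * ψ.gnsStarAlgHom (gauge _ (c j)) * star (twistOp ψ h) = _
  rw [hg, map_smul, star_twistOp, twistOp]
  set p := ψ.gnsStarAlgHom (c j) with hp
  simp only [smul_mul_assoc, mul_smul_comm, add_mul, mul_sub, one_mul, mul_one, hc, neg_mul,
    mul_assoc, Γ_mul_Γ, smul_smul, smul_sub, smul_add, smul_neg]
  have h2 := inv_sqrt_two_mul
  generalize ((√2 : ℝ) : ℂ)⁻¹ = s at *
  match_scalars
  · linear_combination s * s * Complex.I * Complex.I_mul_I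
  · linear_combination h2 - 2 * s * s * Complex.I_mul_I

lemma twistedRep_star_c (j : ℤ) :
    twistedRep ψ h (star (c j)) = Γ ψ h * ψ.gnsStarAlgHom (star (c j)) := by
  rw [map_star, twistedRep_c, star_mul, star_Γ, map_star]

/-- Twisted Haag duality for `Λ`: `π_ψ(𝔄^{CAR}_Λ)'' = π̄_ψ(𝔄^{CAR}_{Λᶜ})'`. -/
def TwistedHaagDuality (Λ : Set ℤ) : Prop :=
  (ψ.gnsStarAlgHom '' (localAlg Λ : Set CAR)).centralizer.centralizer =
    (twistedRep ψ h '' (localAlg Λᶜ : Set CAR)).centralizer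

/-- Duality of the even parts on the GNS space of `ψ₊`:
`π_{ψ₊}((𝔄^{CAR}_Λ)₊)'' = π_{ψ₊}((𝔄^{CAR}_{Λᶜ})₊)'`. -/
def EvenHaagDuality (Λ : Set ℤ) : Prop :=
  ((EvenPart.restrict Θ ψ).gnsStarAlgHom ''
      EvenPart.localPart Θ (localAlg Λ)).centralizer.centralizer =
    ((EvenPart.restrict Θ ψ).gnsStarAlgHom '' EvenPart.localPart Θ (localAlg Λᶜ)).centralizer

end CAR

namespace Spin

variable (φ : Spin →ₚ[ℂ] ℂ)

/-- Haag duality for `Λ` in the GNS representation: `π_φ(𝔄_Λ)'' = π_φ(𝔄_{Λᶜ})'`. -/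
def HaagDuality (Λ : Set ℤ) : Prop :=
  (φ.gnsStarAlgHom '' (localAlg Λ : Set Spin)).centralizer.centralizer =
    (φ.gnsStarAlgHom '' (localAlg Λᶜ : Set Spin)).centralizer

/-- Duality of the even parts on the GNS space of `φ₊`:
`π_{φ₊}((𝔄_Λ)₊)'' = π_{φ₊}((𝔄_{Λᶜ})₊)'`. -/
def EvenHaagDuality (Λ : Set ℤ) : Prop :=
  ((EvenPart.restrict Θ φ).gnsStarAlgHom ''
      EvenPart.localPart Θ (localAlg Λ)).centralizer.centralizer =
    ((EvenPart.restrict Θ φ).gnsStarAlgHom '' EvenPart.localPart Θ (localAlg Λᶜ)).centralizer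

end Spin

end TwistedDuality

end

open scoped ComplexOrder symmDiff

noncomputable section

namespace TwistedDuality

/-! ### Commutants and compressions to the even subspace -/

/-! Let `Γ` be the unitary implementing `Θ` on the GNS space `H`. The GNS space of the restricted
state is the subspace of even vectors, the range of `(1 + Γ) / 2`: the closure of the vectors of
even elements, on which the even algebra acts by restriction. Write `S = π(𝔄_Λ)` and `T =
ρ(𝔄_{Λᶜ})`, where `ρ` is the twisted representation in the CAR case and `π` itself in the spin case.
Let `E`, `F` be their even parts and `E₀`, `F₀` the restrictions of these to the even subspace.
Since `S` and `T` commute, `S'' ⊆ T'` and `E₀'' ⊆ F₀'` always hold; what has to be compared is `T' ⊆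
S''` with `F₀' ⊆ E₀''`.

If `Λ` and `Λᶜ` are both nonempty, `S` and `T` contain odd involutions `U` and `V` (the image of
`c_j + c_j⋆`, respectively of `σ_x`), so that `S = E + E U` and `H` is the sum of the even subspace
and its image under `U`; similarly for `T` and `V`.

From `T' ⊆ S''` to `F₀' ⊆ E₀''`: an operator in `E₀'` is carried to the odd subspace by conjugation
with `U` and so extends to `S'`, and one in `F₀'` extends to `T'` by means of `V` (`hasExtensions`).
The extensions commute, hence so do the restrictions.

From `F₀' ⊆ E₀''` to `T' ⊆ S''`: an even `y` in `T'` restricts to `F₀' ⊆ E₀''`. For `t` in `S'`, the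
compressions of `t`, `V t`, `t V` and `V t V` all belong to `E₀'`, because `V` commutes with `E`;
hence they commute with the restriction of `y`, and this determines all matrix entries of the
commutator of `y` and `t` (`even_mem_bicommutant`). An odd `y` is reduced to this case by
multiplying it with `U`.

If `Λ` is empty or all of `ℤ`, one algebra is trivial and the other is everything; purity makes the
representations irreducible, and both dualities are true.

The twisted representation fits the scheme because it is unitarily conjugate to `π` composed with a
gauge rotation, and the conjugating unitary, a function of `Γ`, is invisible on even elements. -/

section Compression

variable {H H₀ : Type*} [NormedAddCommGroup H] [NormedSpace ℂ H]
  [NormedAddCommGroup H₀] [NormedSpace ℂ H₀]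

/-- `J` identifies `H₀` with the range of the projection `(1 + Γ) / 2`, and `K` is the
corresponding coordinate projection. -/
structure IsEvenCompression (J : H₀ →L[ℂ] H) (K : H →L[ℂ] H₀) (Γ : H →L[ℂ] H) : Prop where
  proj_incl : ∀ x, K (J x) = x
  incl_proj : ∀ ξ, J (K ξ) = (2⁻¹ : ℂ) • (ξ + Γ ξ)

/-- The operator `e` leaves the even subspace invariant and acts there as `e₀`. -/
def Compresses (J : H₀ →L[ℂ] H) (K : H →L[ℂ] H₀) (e : H →L[ℂ] H) (e₀ : H₀ →L[ℂ] H₀) : Prop :=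
  (∀ x, e (J x) = J (e₀ x)) ∧ ∀ ξ, K (e ξ) = e₀ (K ξ)

/-- The set `S` is generated by the even operators `E`, which act as `E₀` on the even subspace,
together with the odd involution `U`. -/
structure IsGradedSet (J : H₀ →L[ℂ] H) (K : H →L[ℂ] H₀) (Γ : H →L[ℂ] H)
    (S E : Set (H →L[ℂ] H)) (E₀ : Set (H₀ →L[ℂ] H₀)) (U : H →L[ℂ] H) : Prop where
  even_subset : E ⊆ S
  odd_mem : U ∈ S
  odd_mul_self : U * U = 1
  odd_anticomm : Γ * U = -(U * Γ)
  conj_mem : ∀ e ∈ E, U * e * U ∈ E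
  decomp : ∀ s ∈ S, ∃ e ∈ E, ∃ e' ∈ E, s = e + e' * U
  compress : ∀ e ∈ E, ∃ e₀ ∈ E₀, Compresses J K e e₀
  lift : ∀ e₀ ∈ E₀, ∃ e ∈ E, Compresses J K e e₀

/-- Operators in the commutant of `E₀` extend to operators in the commutant of `S`. -/
def HasExtensions (J : H₀ →L[ℂ] H) (K : H →L[ℂ] H₀)
    (S : Set (H →L[ℂ] H)) (E₀ : Set (H₀ →L[ℂ] H₀)) : Prop :=
  ∀ s ∈ E₀.centralizer, ∃ t ∈ S.centralizer, Compresses J K t s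

variable {J : H₀ →L[ℂ] H} {K : H →L[ℂ] H₀} {Γ : H →L[ℂ] H}

namespace IsEvenCompression

lemma grading_incl (hJ : IsEvenCompression J K Γ) (x : H₀) : Γ (J x) = J x := by
  have h := hJ.incl_proj (J x)
  rw [hJ.proj_incl] at h
  have h2 := congrArg (fun z => (2 : ℂ) • z) h
  simp only [smul_smul] at h2
  norm_num [two_smul] at h2
  exact h2.symm

lemma proj_grading (hJ : IsEvenCompression J K Γ) (ξ : H) : K (Γ ξ) = K ξ := by
  have h := congrArg K (hJ.incl_proj ξ)
  rw [hJ.proj_incl, map_smul, map_add] at h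
  have h2 := congrArg (fun z => (2 : ℂ) • z) h
  simp only [smul_smul] at h2
  norm_num [two_smul] at h2
  exact h2.symm

lemma grading_grading (hJ : IsEvenCompression J K Γ) (ξ : H) : Γ (Γ ξ) = ξ := by
  have h := hJ.grading_incl (K ξ)
  rw [hJ.incl_proj, map_smul, map_add] at h
  have h2 := congrArg (fun z => (2 : ℂ) • z) h
  simp only [smul_smul] at h2
  norm_num at h2
  rw [add_comm] at h2
  exact add_right_cancel h2

/-- `U` turns even vectors into odd ones, and `K Γ = K` forces `K` to vanish on odd vectors. -/
lemma proj_odd_incl (hJ : IsEvenCompression J K Γ) {U : H →L[ℂ] H}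
    (hU : Γ * U = -(U * Γ)) (x : H₀) : K (U (J x)) = 0 := by
  have h : Γ (U (J x)) = -U (Γ (J x)) := congrArg (fun T => T (J x)) hU
  have h1 := hJ.proj_grading (U (J x))
  rw [h, hJ.grading_incl, map_neg] at h1
  have h2 : (2 : ℂ) • K (U (J x)) = 0 := by
    rw [two_smul]; nth_rewrite 1 [← h1]; exact neg_add_cancel _
  exact (smul_eq_zero.mp h2).resolve_left two_ne_zero

/-- The even part of `ξ` is `J K ξ` and its odd part is `U J K U ξ`, so `K ξ` and `K U ξ` together
determine `ξ`. -/
lemma eq_of_proj (hJ : IsEvenCompression J K Γ) {U : H →L[ℂ] H} (hUU : U * U = 1)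
    (hU : Γ * U = -(U * Γ)) {ξ η : H} (h0 : K ξ = K η) (h1 : K (U ξ) = K (U η)) : ξ = η := by
  have huu (ζ : H) : U (U ζ) = ζ := congrArg (fun T => T ζ) hUU
  have hug (ζ : H) : Γ (U ζ) = -U (Γ ζ) := congrArg (fun T => T ζ) hU
  have e0 := congrArg J h0
  have e1 := congrArg (fun z => U (J z)) h1
  simp only [hJ.incl_proj, map_smul, map_add, huu, hug, map_neg] at e0 e1
  have := congrArg₂ (· + ·) e0 e1
  simp only [← smul_add] at this
  have h2 := congrArg (fun z => (2 : ℂ) • z) this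
  simp only [smul_smul] at h2
  norm_num at h2
  have h3 : (2 : ℂ) • ξ = (2 : ℂ) • η := by
    rw [two_smul, two_smul]
    calc ξ + ξ = ξ + Γ ξ + (ξ + -Γ ξ) := by abel
      _ = _ := h2
      _ = η + η := by abel
  exact smul_right_injective H (two_ne_zero' ℂ) h3

end IsEvenCompression

/-! ### Extension of commutants from the even subspace -/

namespace IsGradedSet

variable {S E T F : Set (H →L[ℂ] H)} {E₀ F₀ : Set (H₀ →L[ℂ] H₀)} {U V : H →L[ℂ] H}

lemma mem_centralizer (hS : IsGradedSet J K Γ S E E₀ U) {t : H →L[ℂ] H}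
    (hE : t ∈ E.centralizer) (hU : U * t = t * U) : t ∈ S.centralizer := by
  intro s hs
  obtain ⟨e, he, e', he', rfl⟩ := hS.decomp s hs
  rw [add_mul, mul_add, hE e he, mul_assoc, hU, ← mul_assoc, hE e' he', mul_assoc]

/-- The extension acts as `s` on even vectors and as the conjugate of `s` by `U` on odd ones.
Conjugation by `U` swaps the two summands, so the sum commutes with `U`. It commutes with `E`
because `J s K` does and `E` is stable under conjugation by `U`. -/
lemma hasExtensions (hJ : IsEvenCompression J K Γ) (hS : IsGradedSet J K Γ S E E₀ U) :
    HasExtensions J K S E₀ := by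
  intro s hs
  have huu (ζ : H) : U (U ζ) = ζ := congrArg (fun T => T ζ) hS.odd_mul_self
  have hz := hJ.proj_odd_incl hS.odd_anticomm
  have hz' (x : H₀) : J (K (U (J x))) = 0 := by rw [hz, map_zero]
  have hX (e : H →L[ℂ] H) (he : e ∈ E) (ξ : H) : e (J (s (K ξ))) = J (s (K (e ξ))) := by
    obtain ⟨e₀, he₀, h1, h2⟩ := hS.compress e he
    rw [h1, h2]
    exact congrArg J (congrArg (fun T => T (K ξ)) (hs e₀ he₀))
  refine ⟨J ∘L s ∘L K + U * (J ∘L s ∘L K) * U, hS.mem_centralizer ?_ ?_, fun x => ?_, fun ξ => ?_⟩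
  · intro e he
    ext ξ
    have hc (ζ : H) : e (U ζ) = U ((U * e * U) ζ) := by
      change _ = U (U (e (U ζ))); rw [huu]
    change e (J (s (K ξ)) + U (J (s (K (U ξ))))) = J (s (K (e ξ))) + U (J (s (K (U (e ξ)))))
    rw [map_add, hX e he, hc, hX _ (hS.conj_mem e he)]
    change _ + U (J (s (K (U (e (U (U ξ))))))) = _
    rw [huu]
  · ext ξ
    change U (J (s (K ξ)) + U (J (s (K (U ξ))))) = J (s (K (U ξ))) + U (J (s (K (U (U ξ)))))
    rw [map_add, huu, huu, add_comm]
  · change J (s (K (J x))) + U (J (s (K (U (J x))))) = _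
    rw [hz, hJ.proj_incl]; simp
  · change K (J (s (K ξ)) + U (J (s (K (U ξ))))) = _
    rw [map_add, hJ.proj_incl, hz, add_zero]

end IsGradedSet

/-- Extend one operator to the commutant of `T` and the other to the commutant of `S`. By hypothesis
the extensions commute, and restricting back to the even subspace is multiplicative on them. -/
lemma centralizer_le_bicommutant_of_hasExtensions {S T : Set (H →L[ℂ] H)}
    {E₀ F₀ : Set (H₀ →L[ℂ] H₀)} (hJ : IsEvenCompression J K Γ)
    (hS : HasExtensions J K S E₀) (hT : HasExtensions J K T F₀)
    (h : T.centralizer ⊆ S.centralizer.centralizer) :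
    F₀.centralizer ⊆ E₀.centralizer.centralizer := by
  intro x hx s hs
  obtain ⟨y, hy, hy1, hy2⟩ := hT x hx
  obtain ⟨t, ht, ht1, ht2⟩ := hS s hs
  ext ξ
  have h1 : K (t (y (J ξ))) = K (y (t (J ξ))) :=
    congrArg K (congrArg (fun T => T (J ξ)) (h hy t ht))
  rwa [ht2, hy2, hJ.proj_incl, hy2, ht2, hJ.proj_incl] at h1

lemma bicommutant_subset_of_subset_centralizer {M : Type*} [Semigroup M] {S T : Set M}
    (h : S ⊆ T.centralizer) : S.centralizer.centralizer ⊆ T.centralizer := by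
  have := Set.centralizer_subset (Set.centralizer_subset h)
  rwa [Set.centralizer_centralizer_centralizer] at this

lemma even_subset_centralizer {S T : Set (H →L[ℂ] H)} {E₀ F₀ : Set (H₀ →L[ℂ] H₀)}
    (hJ : IsEvenCompression J K Γ) (hS : ∀ e₀ ∈ E₀, ∃ e ∈ S, Compresses J K e e₀)
    (hT : ∀ f₀ ∈ F₀, ∃ f ∈ T, Compresses J K f f₀) (hST : S ⊆ T.centralizer) :
    E₀ ⊆ F₀.centralizer := by
  intro e₀ he₀ f₀ hf₀
  obtain ⟨e, he, he1, -⟩ := hS e₀ he₀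
  obtain ⟨f, hf, hf1, -⟩ := hT f₀ hf₀
  ext z
  have h1 : f (e (J z)) = e (f (J z)) := congrArg (fun T => T (J z)) (hST he f hf)
  rw [he1, hf1, hf1, he1] at h1
  have h2 := congrArg K h1
  rwa [hJ.proj_incl, hJ.proj_incl] at h2

/-- Operators extend by zero to the commutant of a set of scalars. -/
lemma hasExtensions_of_scalars {S : Set (H →L[ℂ] H)} {E₀ : Set (H₀ →L[ℂ] H₀)}
    (hJ : IsEvenCompression J K Γ) (hS : ∀ s ∈ S, ∃ z : ℂ, s = z • 1) :
    HasExtensions J K S E₀ := by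
  intro s _
  refine ⟨J ∘L s ∘L K, fun m hm => ?_, fun x => ?_, fun ξ => ?_⟩
  · obtain ⟨z, rfl⟩ := hS m hm
    simp
  · change J (s (K (J x))) = _
    rw [hJ.proj_incl]
  · exact hJ.proj_incl _

/-! ### Duality for graded sets -/

namespace IsGradedSet

variable {S E T F : Set (H →L[ℂ] H)} {E₀ F₀ : Set (H₀ →L[ℂ] H₀)} {U V : H →L[ℂ] H}

/-- An even operator in the commutant of `T` lies in the bicommutant of `S` if its restriction to
the even subspace lies in the bicommutant of `E₀`. -/
lemma even_mem_bicommutant (hJ : IsEvenCompression J K Γ) (hS : IsGradedSet J K Γ S E E₀ U)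
    (hT : IsGradedSet J K Γ T F F₀ V) (hST : S ⊆ T.centralizer)
    (h : F₀.centralizer ⊆ E₀.centralizer.centralizer) {y : H →L[ℂ] H}
    (hy : y ∈ T.centralizer) (hΓ : Γ * y = y * Γ) : y ∈ S.centralizer.centralizer := by
  have hgy (ζ : H) : Γ (y ζ) = y (Γ ζ) := congrArg (fun T => T ζ) hΓ
  have hVy (ζ : H) : V (y ζ) = y (V ζ) := congrArg (fun T => T ζ) (hy V hT.odd_mem)
  have hVV (ζ : H) : V (V ζ) = ζ := congrArg (fun T => T ζ) hT.odd_mul_self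
  set x : H₀ →L[ℂ] H₀ := K ∘L y ∘L J
  -- Since `y` commutes with `Γ`, the even subspace reduces it, and `x` is its restriction there.
  have hKy (ζ : H) : K (y ζ) = x (K ζ) := by
    change _ = K (y (J (K ζ)))
    rw [hJ.incl_proj, map_smul, map_add, ← hgy, map_smul, map_add, hJ.proj_grading,
      ← two_smul ℂ, smul_smul]
    norm_num
  have hyJ (z : H₀) : y (J z) = J (x z) := by
    change _ = J (K (y (J z)))
    rw [hJ.incl_proj, hgy, hJ.grading_incl, ← two_smul ℂ, smul_smul]
    norm_num
  have hxF : x ∈ F₀.centralizer := by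
    intro f₀ hf₀
    obtain ⟨f, hf, h1, h2⟩ := hT.lift f₀ hf₀
    ext z
    change f₀ (K (y (J z))) = K (y (J (f₀ z)))
    rw [← h1, ← h2]
    exact congrArg K (congrArg (fun T => T (J z)) (hy f (hT.even_subset hf)))
  have hxE := h hxF
  -- The operator `r` need not preserve the even subspace; its compression still commutes with `E₀`,
  -- hence with `x`.
  have key (r : H →L[ℂ] H) (hr : r ∈ E.centralizer) (z : H₀) :
      K (r (J (x z))) = x (K (r (J z))) := by
    have hrE : K ∘L r ∘L J ∈ E₀.centralizer := by
      intro e₀ he₀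
      obtain ⟨e, he, h1, h2⟩ := hS.lift e₀ he₀
      ext z
      change e₀ (K (r (J z))) = K (r (J (e₀ z)))
      rw [← h1, ← h2]
      exact congrArg K (congrArg (fun T => T (J z)) (hr e he))
    exact congrArg (fun T => T z) (hxE _ hrE)
  have hVE : V ∈ E.centralizer := fun e he => (hST (hS.even_subset he) V hT.odd_mem).symm
  intro t ht
  have htE : t ∈ E.centralizer := Set.centralizer_subset hS.even_subset ht
  -- The even components are compared through `r`, the odd ones through `V * r`, which again
  -- commutes with `E`.
  have comm (r : H →L[ℂ] H) (hr : r ∈ E.centralizer) (z : H₀) : r (y (J z)) = y (r (J z)) := by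
    refine hJ.eq_of_proj hT.odd_mul_self hT.odd_anticomm ?_ ?_
    · rw [hyJ, key r hr, hKy]
    · rw [hVy, hyJ, hKy]
      exact key (V * r) (Set.mul_mem_centralizer hVE hr) z
  ext ζ
  change t (y ζ) = y (t ζ)
  -- Every vector is an even vector plus `V` applied to an even vector; on the second summand `comm`
  -- is applied to `t * V`.
  have hdec : ζ = J (K ζ) + V (J (K (V ζ))) := by
    have hug : Γ (V ζ) = -V (Γ ζ) := congrArg (fun T => T ζ) hT.odd_anticomm
    rw [hJ.incl_proj, hJ.incl_proj, hug, map_smul, map_add, map_neg, hVV, hVV, ← smul_add]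
    have : ζ + Γ ζ + (ζ + -Γ ζ) = (2 : ℂ) • ζ := by rw [two_smul]; abel
    rw [this, smul_smul]; norm_num
  have e1 := comm t htE (K ζ)
  have e2 := comm (t * V) (Set.mul_mem_centralizer htE hVE) (K (V ζ))
  change t (V (y _)) = y (t (V _)) at e2
  rw [hVy] at e2
  rw [hdec]
  simp only [map_add, e1, e2]

/-- Split `2 y` into the even operator `y + Γ y Γ` and the odd operator `y - Γ y Γ`. The even one
falls under `even_mem_bicommutant`. The odd one does so after multiplication by `U`, which lies in
the commutant of `T` because `S` does; `U` is then removed inside the bicommutant of `S`. -/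
lemma centralizer_subset_bicommutant (hJ : IsEvenCompression J K Γ)
    (hS : IsGradedSet J K Γ S E E₀ U) (hT : IsGradedSet J K Γ T F F₀ V)
    (hST : S ⊆ T.centralizer) (hF : Γ ∈ F.centralizer)
    (h : F₀.centralizer ⊆ E₀.centralizer.centralizer) :
    T.centralizer ⊆ S.centralizer.centralizer := by
  have hΓΓ : Γ * Γ = 1 := ContinuousLinearMap.ext hJ.grading_grading
  intro y hy
  -- `Γ` commutes with `F` and anticommutes with `V`; the two signs from the two factors `Γ` cancel.
  have hyc : Γ * y * Γ ∈ T.centralizer := by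
    refine hT.mem_centralizer (Set.mul_mem_centralizer (Set.mul_mem_centralizer hF
      (Set.centralizer_subset hT.even_subset hy)) hF) ?_
    have h1 : V * Γ = -(Γ * V) := by rw [hT.odd_anticomm, neg_neg]
    have h2 := hy V hT.odd_mem
    calc V * (Γ * y * Γ) = (V * Γ) * y * Γ := by noncomm_ring
      _ = -(Γ * (V * y) * Γ) := by rw [h1]; noncomm_ring
      _ = -(Γ * y * (V * Γ)) := by rw [h2]; noncomm_ring
      _ = Γ * y * Γ * V := by rw [h1]; noncomm_ring
  have hadd (a b : H →L[ℂ] H) (ha : a ∈ T.centralizer) (hb : b ∈ T.centralizer) :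
      a + b ∈ T.centralizer := Set.add_mem_centralizer ha hb
  have hneg (a : H →L[ℂ] H) (ha : a ∈ T.centralizer) : -a ∈ T.centralizer :=
    Set.neg_mem_centralizer ha
  have hUT : U ∈ T.centralizer := hST hS.odd_mem
  have hodd : (y + -(Γ * y * Γ)) * U ∈ S.centralizer.centralizer := by
    refine even_mem_bicommutant hJ hS hT hST h
      (Set.mul_mem_centralizer (hadd _ _ hy (hneg _ hyc)) hUT) ?_
    have h1 : Γ * (y + -(Γ * y * Γ)) = -((y + -(Γ * y * Γ)) * Γ) := by
      have : Γ * (y + -(Γ * y * Γ)) = Γ * y - (Γ * Γ) * y * Γ := by noncomm_ring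
      rw [this, hΓΓ]
      have : -((y + -(Γ * y * Γ)) * Γ) = Γ * y * (Γ * Γ) - y * Γ := by noncomm_ring
      rw [this, hΓΓ]; noncomm_ring
    rw [← mul_assoc, h1, neg_mul, mul_assoc, hS.odd_anticomm, mul_neg, neg_neg, ← mul_assoc]
  have heven : y + Γ * y * Γ ∈ S.centralizer.centralizer := by
    refine even_mem_bicommutant hJ hS hT hST h (hadd _ _ hy hyc) ?_
    have h1 : Γ * (y + Γ * y * Γ) = Γ * y + (Γ * Γ) * y * Γ := by noncomm_ring
    have h2 : (y + Γ * y * Γ) * Γ = y * Γ + Γ * y * (Γ * Γ) := by noncomm_ring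
    rw [h1, h2, hΓΓ]; noncomm_ring
  have hUS : U ∈ S.centralizer.centralizer := Set.subset_centralizer_centralizer hS.odd_mem
  have hodd' := Set.mul_mem_centralizer hodd hUS
  rw [mul_assoc, hS.odd_mul_self, mul_one] at hodd'
  have hsum := Set.add_mem_centralizer heven hodd'
  have h2y : y + Γ * y * Γ + (y + -(Γ * y * Γ)) = (2 : ℂ) • y := by rw [two_smul]; abel
  rw [h2y] at hsum
  intro t ht
  have := hsum t ht
  rw [mul_smul_comm, smul_mul_assoc] at this
  exact smul_right_injective _ (two_ne_zero' ℂ) this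

/-- Duality for the graded sets `S` and `T` is equivalent to duality for their even parts,
restricted to the even subspace. -/
theorem duality_iff (hJ : IsEvenCompression J K Γ) (hS : IsGradedSet J K Γ S E E₀ U)
    (hT : IsGradedSet J K Γ T F F₀ V) (hST : S ⊆ T.centralizer) (hF : Γ ∈ F.centralizer) :
    S.centralizer.centralizer = T.centralizer ↔
      E₀.centralizer.centralizer = F₀.centralizer := by
  constructor
  · intro h
    exact (bicommutant_subset_of_subset_centralizer
      (even_subset_centralizer hJ
        (fun e₀ he₀ => (hS.lift e₀ he₀).imp fun _ h => ⟨hS.even_subset h.1, h.2⟩)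
        (fun f₀ hf₀ => (hT.lift f₀ hf₀).imp fun _ h => ⟨hT.even_subset h.1, h.2⟩) hST)).antisymm
      (centralizer_le_bicommutant_of_hasExtensions hJ (hS.hasExtensions hJ)
        (hT.hasExtensions hJ) h.ge)
  · intro h
    exact (bicommutant_subset_of_subset_centralizer hST).antisymm
      (hS.centralizer_subset_bicommutant hJ hT hST hF h.ge)

end IsGradedSet

end Compression

section General

open scoped InnerProductSpace

variable {A : Type*} [CStarAlgebra A] [PartialOrder A] [StarOrderedRing A] (ψ : A →ₚ[ℂ] ℂ)

/-! ### The GNS representation of a pure state is irreducible -/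

lemma gns_inner_coe (a b : A) :
    ⟪((ψ.toPreGNS a : ψ.PreGNS) : ψ.GNS), ((ψ.toPreGNS b : ψ.PreGNS) : ψ.GNS)⟫_ℂ =
      ψ (star a * b) := by
  rw [UniformSpace.Completion.inner_coe, PositiveLinearMap.preGNS_inner_def]
  rfl

lemma gns_gnsVector (a : A) :
    ψ.gnsStarAlgHom a (gnsVector ψ) = ((ψ.toPreGNS a : ψ.PreGNS) : ψ.GNS) := by
  rw [gnsVector, gns_coe, mul_one]

/-- By cyclicity of the GNS vector `Ω`, an operator `R` in the commutant is determined by its matrix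
entries `⟪π(b)Ω, R π(a)Ω⟫ = ⟪Ω, R π(b⋆a)Ω⟫`. -/
lemma gns_eq_of_inner {S T : ψ.GNS →L[ℂ] ψ.GNS}
    (hS : S ∈ (Set.range ψ.gnsStarAlgHom).centralizer)
    (hT : T ∈ (Set.range ψ.gnsStarAlgHom).centralizer)
    (h : ∀ a, ⟪gnsVector ψ, S (ψ.gnsStarAlgHom a (gnsVector ψ))⟫_ℂ =
      ⟪gnsVector ψ, T (ψ.gnsStarAlgHom a (gnsVector ψ))⟫_ℂ) : S = T := by
  have move (R : ψ.GNS →L[ℂ] ψ.GNS) (hR : R ∈ (Set.range ψ.gnsStarAlgHom).centralizer) (a b : A) :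
      ⟪((ψ.toPreGNS b : ψ.PreGNS) : ψ.GNS), R ((ψ.toPreGNS a : ψ.PreGNS) : ψ.GNS)⟫_ℂ =
        ⟪gnsVector ψ, R (ψ.gnsStarAlgHom (star b * a) (gnsVector ψ))⟫_ℂ := by
    have h1 : R (ψ.gnsStarAlgHom (star b) (ψ.gnsStarAlgHom a (gnsVector ψ))) =
        ψ.gnsStarAlgHom (star b) (R (ψ.gnsStarAlgHom a (gnsVector ψ))) :=
      (congrArg (fun T => T (ψ.gnsStarAlgHom a (gnsVector ψ))) (hR _ ⟨star b, rfl⟩)).symm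
    have h2 : ψ.gnsStarAlgHom (star b * a) (gnsVector ψ) =
        ψ.gnsStarAlgHom (star b) (ψ.gnsStarAlgHom a (gnsVector ψ)) := by rw [map_mul]; rfl
    rw [h2, h1, map_star, ContinuousLinearMap.star_eq_adjoint,
      ContinuousLinearMap.adjoint_inner_right, gns_gnsVector, gns_gnsVector]
  refine gns_ext ψ fun a => ?_
  refine ext_inner_left ℂ fun x => ?_
  induction x using UniformSpace.Completion.induction_on with
  | hp => apply isClosed_eq <;> fun_prop
  | ih x =>
    obtain ⟨b, rfl⟩ := ψ.toPreGNS.surjective x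
    rw [move S hS, move T hT, h]

/-- Put `g(a) = ⟪Ω, S π(a)Ω⟫`. The functionals `ψ ± g` are positive since `-1 ≤ S ≤ 1`, and
normalised since `g(1) = 0`. As `ψ` is their midpoint, extremality gives `g = 0`, hence `S = 0`. -/
lemma gns_commutant_selfAdjoint (hψ : IsPureState ψ) {S : ψ.GNS →L[ℂ] ψ.GNS}
    (hS : S ∈ (Set.range ψ.gnsStarAlgHom).centralizer) (hsa : star S = S)
    (hn : ‖S‖ ≤ 1) (h0 : ⟪gnsVector ψ, S (gnsVector ψ)⟫_ℂ = 0) : S = 0 := by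
  have h1 : ψ 1 = 1 := hψ.1.2
  have sym (x y : ψ.GNS) : ⟪S x, y⟫_ℂ = ⟪x, S y⟫_ℂ := by
    nth_rewrite 1 [← hsa]
    rw [ContinuousLinearMap.star_eq_adjoint, ContinuousLinearMap.adjoint_inner_left]
  let g : A →ₗ[ℂ] ℂ :=
    { toFun := fun a => ⟪gnsVector ψ, S (ψ.gnsStarAlgHom a (gnsVector ψ))⟫_ℂ
      map_add' := fun a b => by
        rw [map_add, add_apply, map_add, inner_add_right]
      map_smul' := fun r a => by
        rw [map_smul, smul_apply, map_smul, inner_smul_right]; rfl }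
  have hg (a : A) : g (star a * a) =
      ⟪((ψ.toPreGNS a : ψ.PreGNS) : ψ.GNS), S ((ψ.toPreGNS a : ψ.PreGNS) : ψ.GNS)⟫_ℂ := by
    have h2 : S (ψ.gnsStarAlgHom (star a) (ψ.gnsStarAlgHom a (gnsVector ψ))) =
        ψ.gnsStarAlgHom (star a) (S (ψ.gnsStarAlgHom a (gnsVector ψ))) :=
      (congrArg (fun T => T (ψ.gnsStarAlgHom a (gnsVector ψ))) (hS _ ⟨star a, rfl⟩)).symm
    change ⟪gnsVector ψ, S (ψ.gnsStarAlgHom (star a * a) (gnsVector ψ))⟫_ℂ = _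
    have h3 : ψ.gnsStarAlgHom (star a * a) (gnsVector ψ) =
        ψ.gnsStarAlgHom (star a) (ψ.gnsStarAlgHom a (gnsVector ψ)) := by rw [map_mul]; rfl
    rw [h3, h2, map_star, ContinuousLinearMap.star_eq_adjoint,
      ContinuousLinearMap.adjoint_inner_right, gns_gnsVector]
  have hreal (x : ψ.GNS) : ∃ r : ℝ, ⟪x, S x⟫_ℂ = (r : ℂ) ∧ |r| ≤ ‖x‖ ^ 2 := by
    have hc : (starRingEnd ℂ) ⟪x, S x⟫_ℂ = ⟪x, S x⟫_ℂ := by rw [inner_conj_symm, sym]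
    obtain ⟨r, hr⟩ := Complex.conj_eq_iff_real.mp hc
    refine ⟨r, hr, ?_⟩
    have h4 : ‖(r : ℂ)‖ ≤ ‖x‖ * ‖S x‖ := hr ▸ norm_inner_le_norm x (S x)
    rw [Complex.norm_real, Real.norm_eq_abs] at h4
    have h5 : ‖S x‖ ≤ ‖x‖ := (S.le_of_opNorm_le hn x).trans_eq (one_mul _)
    nlinarith [norm_nonneg x]
  have hψsq (a : A) : ψ (star a * a) =
      ((‖((ψ.toPreGNS a : ψ.PreGNS) : ψ.GNS)‖ ^ 2 : ℝ) : ℂ) := by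
    rw [← gns_inner_coe, inner_self_eq_norm_sq_to_K]; push_cast; rfl
  have hg1 : g 1 = 0 := by
    change ⟪gnsVector ψ, S (ψ.gnsStarAlgHom 1 (gnsVector ψ))⟫_ℂ = 0
    rw [map_one]; exact h0
  have hplus : ψ.toLinearMap + g ∈ stateSpace A := by
    refine ⟨fun a => ?_, ?_⟩
    · change 0 ≤ ψ (star a * a) + g (star a * a)
      obtain ⟨r, hr, hr'⟩ := hreal ((ψ.toPreGNS a : ψ.PreGNS) : ψ.GNS)
      rw [hψsq, hg, hr, ← Complex.ofReal_add]
      exact_mod_cast (by linarith [neg_abs_le r])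
    · change ψ 1 + g 1 = 1
      rw [h1, hg1, add_zero]
  have hminus : ψ.toLinearMap - g ∈ stateSpace A := by
    refine ⟨fun a => ?_, ?_⟩
    · change 0 ≤ ψ (star a * a) - g (star a * a)
      obtain ⟨r, hr, hr'⟩ := hreal ((ψ.toPreGNS a : ψ.PreGNS) : ψ.GNS)
      rw [hψsq, hg, hr, ← Complex.ofReal_sub]
      exact_mod_cast (by linarith [le_abs_self r])
    · change ψ 1 - g 1 = 1
      rw [h1, hg1, sub_zero]
  have hseg : ψ.toLinearMap ∈ openSegment ℝ (ψ.toLinearMap + g) (ψ.toLinearMap - g) := by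
    refine ⟨2⁻¹, 2⁻¹, by norm_num, by norm_num, by norm_num, ?_⟩
    rw [← smul_add, add_add_sub_cancel, ← two_smul ℝ, smul_smul]
    norm_num
  have hext := (mem_extremePoints.mp hψ).2 _ hplus _ hminus hseg
  have hg0 : g = 0 := by simpa using hext.1
  refine gns_eq_of_inner ψ hS (by intro m _; simp) fun a => ?_
  change g a = _
  rw [hg0]; simp

/-- The commutant of the GNS representation of a pure state consists of scalars. -/
theorem gns_commutant_eq_scalar (hψ : IsPureState ψ) {T : ψ.GNS →L[ℂ] ψ.GNS}
    (hT : T ∈ (Set.range ψ.gnsStarAlgHom).centralizer) : ∃ z : ℂ, T = z • 1 := by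
  have h1 : ψ 1 = 1 := hψ.1.2
  have hone (z : ℂ) : z • (1 : ψ.GNS →L[ℂ] ψ.GNS) ∈ (Set.range ψ.gnsStarAlgHom).centralizer := by
    intro m _; simp
  have hsmul (z : ℂ) (R : ψ.GNS →L[ℂ] ψ.GNS) (hR : R ∈ (Set.range ψ.gnsStarAlgHom).centralizer) :
      z • R ∈ (Set.range ψ.gnsStarAlgHom).centralizer := by
    intro m hm; rw [mul_smul_comm, smul_mul_assoc, hR m hm]
  have hstar : star T ∈ (Set.range ψ.gnsStarAlgHom).centralizer := by
    rintro _ ⟨a, rfl⟩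
    have := congrArg star (hT _ ⟨star a, rfl⟩)
    rwa [star_mul, star_mul, map_star, star_star, eq_comm] at this
  have hΩ : ⟪gnsVector ψ, gnsVector ψ⟫_ℂ = 1 := by
    rw [gnsVector, gns_inner_coe, star_one, mul_one, h1]
  have main (S : ψ.GNS →L[ℂ] ψ.GNS) (hS : S ∈ (Set.range ψ.gnsStarAlgHom).centralizer)
      (hsa : star S = S) : ∃ z : ℂ, S = z • 1 := by
    set s := ⟪gnsVector ψ, S (gnsVector ψ)⟫_ℂ with hs
    refine ⟨s, ?_⟩
    have hss : star s = s := by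
      rw [hs, Complex.star_def, inner_conj_symm]
      nth_rewrite 1 [← hsa]
      rw [ContinuousLinearMap.star_eq_adjoint, ContinuousLinearMap.adjoint_inner_left]
    -- Subtracting the expectation `s` and rescaling brings `S` into the form required by
    -- `gns_commutant_selfAdjoint`; the `+ 1` in the scale avoids the case `R = 0`.
    have hR : S + (-s) • 1 ∈ (Set.range ψ.gnsStarAlgHom).centralizer :=
      Set.add_mem_centralizer hS (hone _)
    set R := S + (-s) • 1 with hRdef
    set r : ℝ := (‖R‖ + 1)⁻¹ with hr
    have hrpos : 0 < r := by positivity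
    have h0 : (r : ℂ) • R = 0 := by
      refine gns_commutant_selfAdjoint ψ hψ (hsmul _ _ hR) ?_ ?_ ?_
      · rw [star_smul, hRdef, star_add, hsa, star_smul, star_one, star_neg, hss]
        simp
      · rw [norm_smul, Complex.norm_real, Real.norm_of_nonneg hrpos.le, hr,
          inv_mul_le_one₀ (by positivity)]
        linarith
      · rw [smul_apply, inner_smul_right, hRdef, add_apply, inner_add_right, smul_apply,
          inner_smul_right, ← hs, one_apply_eq_self, hΩ]
        ring
    have hR0 : R = 0 := (smul_eq_zero.mp h0).resolve_left (by exact_mod_cast hrpos.ne')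
    rw [hRdef, neg_smul, add_neg_eq_zero] at hR0
    exact hR0
  -- The general case follows from the self-adjoint operators `T + T⋆` and `i(T - T⋆)`.
  obtain ⟨z, hz⟩ := main (T + star T) (Set.add_mem_centralizer hT hstar)
    (by rw [star_add, star_star, add_comm])
  obtain ⟨w, hw⟩ := main (Complex.I • (T + (-1 : ℂ) • star T))
    (hsmul _ _ (Set.add_mem_centralizer hT (hsmul _ _ hstar)))
    (by
      rw [star_smul, star_add, star_smul, star_star]
      simp only [Complex.star_def, Complex.conj_I, star_neg, star_one]
      module)
  refine ⟨2⁻¹ * (z - Complex.I * w), ?_⟩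
  have h2 : T = (2⁻¹ : ℂ) • ((T + star T) - Complex.I • (Complex.I • (T + (-1 : ℂ) • star T))) := by
    rw [smul_smul, Complex.I_mul_I]; module
  rw [h2, hz, hw]
  module

end General

section General

open scoped InnerProductSpace

variable {A : Type*} [CStarAlgebra A] [PartialOrder A] [StarOrderedRing A] (ψ : A →ₚ[ℂ] ℂ)
  (θ : A →⋆ₐ[ℂ] A)

/-! ### The GNS space of the even part -/

lemma restrict_apply (a : EvenPart θ) :
    EvenPart.restrict θ ψ a = ψ (EvenPart.incl θ a) := rfl

/-- The isometry from the GNS space of `ψ₊` to the GNS space of `ψ`. -/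
def evenIsometry : (EvenPart.restrict θ ψ).GNS →L[ℂ] ψ.GNS :=
  ContinuousLinearMap.completion (LinearMap.mkContinuous
    (ψ.toPreGNS.toLinearMap ∘ₗ (EvenPart.incl θ).toAlgHom.toLinearMap ∘ₗ
      (EvenPart.restrict θ ψ).ofPreGNS.toLinearMap) 1 fun x => by
      rw [one_mul, PositiveLinearMap.preGNS_norm_def, PositiveLinearMap.preGNS_norm_def,
        restrict_apply, map_mul (EvenPart.incl θ), map_star (EvenPart.incl θ)]
      exact le_rfl)

lemma evenIsometry_coe (a : EvenPart θ) :
    evenIsometry ψ θ ((EvenPart.restrict θ ψ).toPreGNS a : (EvenPart.restrict θ ψ).PreGNS) =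
      (ψ.toPreGNS (EvenPart.incl θ a) : ψ.PreGNS) :=
  ContinuousLinearMap.completion_apply_coe _ _

lemma inner_evenIsometry (x y : (EvenPart.restrict θ ψ).GNS) :
    ⟪evenIsometry ψ θ x, evenIsometry ψ θ y⟫_ℂ = ⟪x, y⟫_ℂ := by
  induction x, y using UniformSpace.Completion.induction_on₂ with
  | hp => apply isClosed_eq <;> fun_prop
  | ih x y =>
    obtain ⟨x, rfl⟩ := (EvenPart.restrict θ ψ).toPreGNS.surjective x
    obtain ⟨y, rfl⟩ := (EvenPart.restrict θ ψ).toPreGNS.surjective y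
    rw [evenIsometry_coe, evenIsometry_coe, gns_inner_coe, gns_inner_coe, restrict_apply,
      map_mul (EvenPart.incl θ), map_star (EvenPart.incl θ)]

lemma incl_fixed (a : EvenPart θ) : θ (EvenPart.incl θ a) = EvenPart.incl θ a := a.2

/-- Even elements of `A`, as elements of the even part. -/
def toEven (a : A) (ha : θ a = a) : EvenPart θ := ⟨a, ha⟩

lemma incl_toEven (a : A) (ha : θ a = a) : EvenPart.incl θ (toEven θ a ha) = a := rfl

lemma isEvenCompression (h : ∀ a, ψ (θ a) = ψ a) (hθ : ∀ a, θ (θ a) = a) :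
    IsEvenCompression (evenIsometry ψ θ) (ContinuousLinearMap.adjoint (evenIsometry ψ θ))
      (parityOp ψ θ h) := by
  have hKJ (x : (EvenPart.restrict θ ψ).GNS) :
      ContinuousLinearMap.adjoint (evenIsometry ψ θ) (evenIsometry ψ θ x) = x := by
    refine ext_inner_left ℂ fun y => ?_
    rw [ContinuousLinearMap.adjoint_inner_right, inner_evenIsometry]
  refine ⟨hKJ, fun ξ => ?_⟩
  have hΓJ (x : (EvenPart.restrict θ ψ).GNS) :
      parityOp ψ θ h (evenIsometry ψ θ x) = evenIsometry ψ θ x := by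
    induction x using UniformSpace.Completion.induction_on with
    | hp => apply isClosed_eq <;> fun_prop
    | ih x =>
      obtain ⟨x, rfl⟩ := (EvenPart.restrict θ ψ).toPreGNS.surjective x
      rw [evenIsometry_coe, parityOp_coe, incl_fixed]
  have hKΓ (ζ : ψ.GNS) : ContinuousLinearMap.adjoint (evenIsometry ψ θ) (parityOp ψ θ h ζ) =
      ContinuousLinearMap.adjoint (evenIsometry ψ θ) ζ := by
    refine ext_inner_left ℂ fun y => ?_
    rw [ContinuousLinearMap.adjoint_inner_right, ContinuousLinearMap.adjoint_inner_right,
      ← star_parityOp ψ θ h hθ, ContinuousLinearMap.star_eq_adjoint,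
      ContinuousLinearMap.adjoint_inner_right, hΓJ]
  -- On the vector of `a`, the adjoint does not distinguish `a` from its average `(a + θ a) / 2`,
  -- whose vector already lies in the range of the isometry.
  have hJK : evenIsometry ψ θ ∘L ContinuousLinearMap.adjoint (evenIsometry ψ θ) =
      (2⁻¹ : ℂ) • (1 + parityOp ψ θ h) := by
    refine gns_ext ψ fun a => ?_
    have he : θ ((2⁻¹ : ℂ) • (a + θ a)) = (2⁻¹ : ℂ) • (a + θ a) := by
      rw [map_smul, map_add, hθ, add_comm]
    have h1 : (2⁻¹ : ℂ) • (((ψ.toPreGNS a : ψ.PreGNS) : ψ.GNS) +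
        parityOp ψ θ h (ψ.toPreGNS a : ψ.PreGNS)) =
        evenIsometry ψ θ ((EvenPart.restrict θ ψ).toPreGNS (toEven θ _ he) :
          (EvenPart.restrict θ ψ).PreGNS) := by
      rw [evenIsometry_coe, incl_toEven, parityOp_coe, map_smul, map_add,
        UniformSpace.Completion.coe_smul, UniformSpace.Completion.coe_add]
    have h2 : ContinuousLinearMap.adjoint (evenIsometry ψ θ) (ψ.toPreGNS a : ψ.PreGNS) =
        ContinuousLinearMap.adjoint (evenIsometry ψ θ)
          ((2⁻¹ : ℂ) • (((ψ.toPreGNS a : ψ.PreGNS) : ψ.GNS) +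
            parityOp ψ θ h (ψ.toPreGNS a : ψ.PreGNS))) := by
      rw [map_smul, map_add, hKΓ, ← two_smul ℂ, smul_smul]; norm_num
    change evenIsometry ψ θ (ContinuousLinearMap.adjoint (evenIsometry ψ θ) _) =
      (2⁻¹ : ℂ) • (((ψ.toPreGNS a : ψ.PreGNS) : ψ.GNS) +
        parityOp ψ θ h (ψ.toPreGNS a : ψ.PreGNS))
    rw [h2, h1, hKJ]
  exact congrArg (fun T => T ξ) hJK

lemma gns_evenIsometry (a : EvenPart θ) (x : (EvenPart.restrict θ ψ).GNS) :
    ψ.gnsStarAlgHom (EvenPart.incl θ a) (evenIsometry ψ θ x) =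
      evenIsometry ψ θ ((EvenPart.restrict θ ψ).gnsStarAlgHom a x) := by
  induction x using UniformSpace.Completion.induction_on with
  | hp => apply isClosed_eq <;> fun_prop
  | ih x =>
    obtain ⟨x, rfl⟩ := (EvenPart.restrict θ ψ).toPreGNS.surjective x
    rw [evenIsometry_coe, gns_coe, gns_coe, evenIsometry_coe, map_mul (EvenPart.incl θ)]

/-- The second relation is the adjoint of the first one, taken for `star a`. -/
lemma compresses_gns (a : EvenPart θ) :
    Compresses (evenIsometry ψ θ) (ContinuousLinearMap.adjoint (evenIsometry ψ θ))
      (ψ.gnsStarAlgHom (EvenPart.incl θ a)) ((EvenPart.restrict θ ψ).gnsStarAlgHom a) := by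
  refine ⟨gns_evenIsometry ψ θ a, fun ξ => ?_⟩
  refine ext_inner_left ℂ fun y => ?_
  have h1 := gns_evenIsometry ψ θ (star a) y
  have h2 : ψ.gnsStarAlgHom (EvenPart.incl θ a) =
      star (ψ.gnsStarAlgHom (EvenPart.incl θ (star a))) := by
    rw [map_star, map_star, star_star]
  have h3 : (EvenPart.restrict θ ψ).gnsStarAlgHom a =
      star ((EvenPart.restrict θ ψ).gnsStarAlgHom (star a)) := by
    rw [map_star, star_star]
  rw [h2, h3, ContinuousLinearMap.star_eq_adjoint, ContinuousLinearMap.star_eq_adjoint,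
    ContinuousLinearMap.adjoint_inner_right, ContinuousLinearMap.adjoint_inner_right,
    ContinuousLinearMap.adjoint_inner_right, ContinuousLinearMap.adjoint_inner_right, h1]

/-- The elements of `B` fixed by `θ`. -/
def evenElements (B : StarSubalgebra ℂ A) : Set A := {b | b ∈ B ∧ θ b = b}

/-! ### Duality of subalgebras in the GNS space -/

variable {ψ θ}

/-- The odd part of `b` is `((b - θ b) / 2) u` times `u`, with an even first factor. Only the images
of the even elements under `ρ` and `π` must agree, not their values: the twisted representation
differs from `π` on even elements by a gauge rotation. -/
lemma isGradedSet (h : ∀ a, ψ (θ a) = ψ a) (hθ : ∀ a, θ (θ a) = a) {B : StarSubalgebra ℂ A}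
    (hB : ∀ b ∈ B, θ b ∈ B) {ρ : A →⋆ₐ[ℂ] (ψ.GNS →L[ℂ] ψ.GNS)}
    (hρ : ρ '' evenElements θ B = ψ.gnsStarAlgHom '' evenElements θ B)
    (hΓ : ∀ a, parityOp ψ θ h * ρ a = ρ (θ a) * parityOp ψ θ h)
    {u : A} (hu : u ∈ B) (huu : u * u = 1) (hθu : θ u = -u) :
    IsGradedSet (evenIsometry ψ θ) (ContinuousLinearMap.adjoint (evenIsometry ψ θ))
      (parityOp ψ θ h) (ρ '' B) (ψ.gnsStarAlgHom '' evenElements θ B)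
      ((EvenPart.restrict θ ψ).gnsStarAlgHom '' EvenPart.localPart θ B) (ρ u) where
  even_subset := by
    rw [← hρ]
    exact Set.image_mono fun b hb => hb.1
  odd_mem := ⟨u, hu, rfl⟩
  odd_mul_self := by rw [← map_mul, huu, map_one]
  odd_anticomm := by rw [hΓ, hθu, map_neg, neg_mul]
  conj_mem := by
    rw [← hρ]
    rintro _ ⟨e, he, rfl⟩
    refine ⟨u * e * u, ⟨mul_mem (mul_mem hu he.1) hu, ?_⟩, by simp only [map_mul]⟩
    rw [map_mul, map_mul, hθu, he.2]; noncomm_ring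
  decomp := by
    rw [← hρ]
    rintro _ ⟨b, hb, rfl⟩
    have hs (x : A) (hx : x ∈ B) (z : ℂ) : z • x ∈ B := SMulMemClass.smul_mem z hx
    refine ⟨_, ⟨(2⁻¹ : ℂ) • (b + θ b), ⟨hs _ (add_mem hb (hB b hb)) _, ?_⟩, rfl⟩,
      _, ⟨((2⁻¹ : ℂ) • (b - θ b)) * u, ⟨mul_mem (hs _ (sub_mem hb (hB b hb)) _) hu, ?_⟩, rfl⟩, ?_⟩
    · rw [map_smul, map_add, hθ, add_comm]
    · rw [map_mul, map_smul, map_sub, hθ, hθu, mul_neg, ← neg_mul, ← smul_neg, neg_sub]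
    · rw [← map_mul, mul_assoc, huu, mul_one, ← map_add]
      congr 1
      module
  compress := by
    rintro _ ⟨e, he, rfl⟩
    exact ⟨_, ⟨toEven θ e he.2, he.1, rfl⟩, compresses_gns ψ θ (toEven θ e he.2)⟩
  lift := by
    rintro _ ⟨a, ha, rfl⟩
    exact ⟨_, ⟨EvenPart.incl θ a, ⟨ha, incl_fixed θ a⟩, rfl⟩, compresses_gns ψ θ a⟩

lemma parityOp_mem_centralizer (h : ∀ a, ψ (θ a) = ψ a) (B : StarSubalgebra ℂ A) :
    parityOp ψ θ h ∈ (ψ.gnsStarAlgHom '' evenElements θ B).centralizer := by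
  rintro _ ⟨b, hb, rfl⟩
  rw [parityOp_mul_gns, hb.2]

/-- Duality between a subalgebra `B` in the GNS representation and a subalgebra `C` in an
irreducible representation `ρ`, which agrees with the GNS representation on even parts, is
equivalent to the duality of the even parts. -/
theorem gns_duality_iff (hψ : IsPureState ψ) (h : ∀ a, ψ (θ a) = ψ a) (hθ : ∀ a, θ (θ a) = a)
    {B C : StarSubalgebra ℂ A} (hB : ∀ b ∈ B, θ b ∈ B) (hC : ∀ b ∈ C, θ b ∈ C)
    {ρ : A →⋆ₐ[ℂ] (ψ.GNS →L[ℂ] ψ.GNS)}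
    (hρ : ρ '' evenElements θ C = ψ.gnsStarAlgHom '' evenElements θ C)
    (hΓ : ∀ a, parityOp ψ θ h * ρ a = ρ (θ a) * parityOp ψ θ h)
    (hirr : ∀ T ∈ (Set.range ρ).centralizer, ∃ z : ℂ, T = z • 1)
    (hBC : ψ.gnsStarAlgHom '' B ⊆ (ρ '' C).centralizer)
    (hBu : (∃ u ∈ B, u * u = 1 ∧ θ u = -u) ∨ B = ⊥ ∧ C = ⊤)
    (hCv : (∃ v ∈ C, v * v = 1 ∧ θ v = -v) ∨ C = ⊥ ∧ B = ⊤) :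
    (ψ.gnsStarAlgHom '' B).centralizer.centralizer = (ρ '' C).centralizer ↔
      ((EvenPart.restrict θ ψ).gnsStarAlgHom '' EvenPart.localPart θ B).centralizer.centralizer =
        ((EvenPart.restrict θ ψ).gnsStarAlgHom '' EvenPart.localPart θ C).centralizer := by
  have hJ := isEvenCompression ψ θ h hθ
  have graded (u : A) (hu : u ∈ B ∧ u * u = 1 ∧ θ u = -u) :=
    isGradedSet h hθ hB rfl (parityOp_mul_gns ψ θ h) hu.1 hu.2.1 hu.2.2
  have graded' (v : A) (hv : v ∈ C ∧ v * v = 1 ∧ θ v = -v) :=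
    isGradedSet h hθ hC hρ hΓ hv.1 hv.2.1 hv.2.2
  have scalars (D : StarSubalgebra ℂ A) (hD : D = ⊥) (π : A →⋆ₐ[ℂ] (ψ.GNS →L[ℂ] ψ.GNS)) :
      ∀ s ∈ π '' D, ∃ z : ℂ, s = z • 1 := by
    rintro _ ⟨b, hb, rfl⟩
    rw [hD] at hb
    obtain ⟨z, rfl⟩ := StarSubalgebra.mem_bot.mp hb
    exact ⟨z, by rw [Algebra.algebraMap_eq_smul_one, map_smul, map_one]⟩
  -- For trivial `B` or `C` the equivalence is proved by showing that both sides are true;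
  -- extensions then come from an odd involution or, for scalars, by zero.
  have both (hd : (ρ '' C).centralizer ⊆ (ψ.gnsStarAlgHom '' B).centralizer.centralizer) :
      (ψ.gnsStarAlgHom '' B).centralizer.centralizer = (ρ '' C).centralizer ∧
      ((EvenPart.restrict θ ψ).gnsStarAlgHom '' EvenPart.localPart θ B).centralizer.centralizer =
        ((EvenPart.restrict θ ψ).gnsStarAlgHom '' EvenPart.localPart θ C).centralizer := by
    refine ⟨(bicommutant_subset_of_subset_centralizer hBC).antisymm hd,
      (bicommutant_subset_of_subset_centralizer (even_subset_centralizer hJ ?_ ?_ hBC)).antisymm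
        (centralizer_le_bicommutant_of_hasExtensions hJ ?_ ?_ hd)⟩
    · rintro _ ⟨a, ha, rfl⟩
      exact ⟨_, ⟨EvenPart.incl θ a, ha, rfl⟩, compresses_gns ψ θ a⟩
    · rintro _ ⟨a, ha, rfl⟩
      have hm : ψ.gnsStarAlgHom (EvenPart.incl θ a) ∈ ρ '' evenElements θ C :=
        hρ ▸ ⟨_, ⟨ha, incl_fixed θ a⟩, rfl⟩
      exact ⟨_, Set.image_mono (fun b hb => hb.1) hm, compresses_gns ψ θ a⟩
    · rcases hBu with ⟨u, hu⟩ | ⟨hbot, -⟩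
      · exact (graded u hu).hasExtensions hJ
      · exact hasExtensions_of_scalars hJ (scalars B hbot _)
    · rcases hCv with ⟨v, hv⟩ | ⟨hbot, -⟩
      · exact (graded' v hv).hasExtensions hJ
      · exact hasExtensions_of_scalars hJ (scalars C hbot _)
  rcases hBu with ⟨u, hu⟩ | ⟨-, htop⟩
  · rcases hCv with ⟨v, hv⟩ | ⟨-, htop⟩
    · exact (graded u hu).duality_iff hJ (graded' v hv) hBC (parityOp_mem_centralizer h C)
    · have hd : (ρ '' C).centralizer ⊆ (ψ.gnsStarAlgHom '' B).centralizer.centralizer := by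
        intro y _ t ht
        rw [htop, StarSubalgebra.coe_top, Set.image_univ] at ht
        obtain ⟨z, rfl⟩ := gns_commutant_eq_scalar ψ hψ ht
        simp
      exact iff_of_true (both hd).1 (both hd).2
  -- Here `C` is the whole algebra, and irreducibility of `ρ` leaves only scalars in its commutant.
  · have hd : (ρ '' C).centralizer ⊆ (ψ.gnsStarAlgHom '' B).centralizer.centralizer := by
      intro y hy t _
      rw [htop, StarSubalgebra.coe_top, Set.image_univ] at hy
      obtain ⟨z, rfl⟩ := hirr y hy
      simp
    exact iff_of_true (both hd).1 (both hd).2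

end General

/-! ### Generated subalgebras -/

section Generated

variable {B : Type*} [CStarAlgebra B]

lemma cstarGen_le {s : Set B} {S : StarSubalgebra ℂ B} (hS : IsClosed (S : Set B)) (h : s ⊆ S) :
    cstarGen s ≤ S :=
  StarSubalgebra.topologicalClosure_minimal (StarAlgebra.adjoin_le h) hS

lemma cstarGen_empty : cstarGen (∅ : Set B) = ⊥ := by
  refine le_antisymm (cstarGen_le ?_ (Set.empty_subset _)) bot_le
  have h : ((⊥ : StarSubalgebra ℂ B) : Set B) = (Submodule.span ℂ {(1 : B)} : Submodule ℂ B) := by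
    ext x
    simp [Submodule.mem_span_singleton, Algebra.algebraMap_eq_smul_one]
  rw [h]
  exact Submodule.closed_of_finiteDimensional _

open scoped CStarAlgebra in
/-- Representations of two generated C⋆-algebras commute if they do so on generators. -/
lemma commute_cstarGen {A₁ A₂ : Type*} [CStarAlgebra A₁] [CStarAlgebra A₂]
    (ρ₁ : A₁ →⋆ₐ[ℂ] B) (ρ₂ : A₂ →⋆ₐ[ℂ] B) {s₁ : Set A₁} {s₂ : Set A₂}
    (h : ∀ x ∈ s₁, ∀ y ∈ s₂, ρ₂ y * ρ₁ x = ρ₁ x * ρ₂ y ∧ ρ₂ (star y) * ρ₁ x = ρ₁ x * ρ₂ (star y)) :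
    ρ₁ '' cstarGen s₁ ⊆ (ρ₂ '' cstarGen s₂).centralizer := by
  have hcl (s : Set B) : IsClosed (StarSubalgebra.centralizer ℂ s : Set B) := by
    rw [StarSubalgebra.coe_centralizer]
    exact Set.isClosed_centralizer _
  have h1 : cstarGen s₁ ≤ (StarSubalgebra.centralizer ℂ (ρ₂ '' s₂)).comap ρ₁ := by
    refine cstarGen_le ((hcl _).preimage (map_continuous ρ₁ : Continuous ρ₁)) fun x hx => ?_
    refine (StarSubalgebra.mem_centralizer_iff ℂ).mpr ?_
    rintro _ ⟨y, hy, rfl⟩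
    rw [← map_star]
    exact h x hx y hy
  -- A second closure argument, now in the other variable and against all of `cstarGen s₁`.
  have h2 : cstarGen s₂ ≤ (StarSubalgebra.centralizer ℂ (ρ₁ '' cstarGen s₁)).comap ρ₂ := by
    refine cstarGen_le ((hcl _).preimage (map_continuous ρ₂ : Continuous ρ₂)) fun y hy => ?_
    refine (StarSubalgebra.mem_centralizer_iff ℂ).mpr ?_
    rintro _ ⟨x, hx, rfl⟩
    have e1 := (StarSubalgebra.mem_centralizer_iff ℂ).mp (h1 hx) _ ⟨y, hy, rfl⟩
    have e2 := (StarSubalgebra.mem_centralizer_iff ℂ).mp (h1 (star_mem hx)) _ ⟨y, hy, rfl⟩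
    exact ⟨e1.1.symm, map_star ρ₁ x ▸ e2.1.symm⟩
  rintro _ ⟨x, hx, rfl⟩ _ ⟨y, hy, rfl⟩
  exact (((StarSubalgebra.mem_centralizer_iff ℂ).mp (h2 hy) _ ⟨x, hx, rfl⟩).1).symm

/-- A C⋆-algebra embedded onto the C⋆-algebra generated by `s` is generated by the preimage
of `s`. -/
lemma cstarGen_eq_top {A : Type*} [CStarAlgebra A] {s : Set B} {t : Set A} (ι : A →⋆ₐ[ℂ] B)
    (hι : Isometry ι) (hr : ∀ a, ι a ∈ cstarGen s) (hst : s ⊆ ι '' t) : cstarGen t = ⊤ := by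
  have h1 : cstarGen s ≤ (cstarGen t).map ι := by
    refine cstarGen_le ?_ ?_
    · rw [StarSubalgebra.coe_map]
      exact hι.isClosedEmbedding.isClosedMap _ (isClosed_cstarGen t)
    · rw [StarSubalgebra.coe_map]
      exact hst.trans (Set.image_mono (subset_cstarGen t))
  refine eq_top_iff.mpr fun a _ => ?_
  obtain ⟨b, hb, hab⟩ := h1 (hr a)
  rwa [← hι.injective hab]

end Generated

open scoped CStarAlgebra

/-! ### The CAR algebra -/

namespace CAR

lemma gaugeUnitary_add (s t : ℝ) :
    (gaugeUnitary (s + t) : Fock →L[ℂ] Fock) = gaugeUnitary s * gaugeUnitary t := by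
  ext ξ G
  change (Circle.exp (s + t) : ℂ) ^ G.card * ξ G =
    (Circle.exp s : ℂ) ^ G.card * ((Circle.exp t : ℂ) ^ G.card * ξ G)
  rw [Circle.exp_add, Circle.coe_mul, mul_pow, mul_assoc]

lemma gauge_gauge (s t : ℝ) (a : CAR) : gauge s (gauge t a) = gauge (s + t) a := by
  refine Subtype.ext ?_
  change gaugeConj s (gaugeConj t a.1) = gaugeConj (s + t) a.1
  rw [gaugeConj_apply, gaugeConj_apply, gaugeConj_apply, gaugeUnitary_add, star_mul]
  simp only [mul_assoc]

lemma gauge_zero (a : CAR) : gauge 0 a = a := by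
  have h : (gaugeUnitary 0 : Fock →L[ℂ] Fock) = 1 := by
    ext ξ G
    change (Circle.exp 0 : ℂ) ^ G.card * ξ G = ξ G
    simp
  refine Subtype.ext ?_
  change gaugeConj 0 a.1 = a.1
  rw [gaugeConj_apply, h, star_one, one_mul, mul_one]

lemma gauge_neg_gauge (t : ℝ) (a : CAR) : gauge t (gauge (-t) a) = a := by
  rw [gauge_gauge, add_neg_cancel, gauge_zero]

lemma Θ_gauge (t : ℝ) (a : CAR) : Θ (gauge t a) = gauge t (Θ a) := by
  rw [Θ, gauge_gauge, gauge_gauge, add_comm]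

lemma gauge_mem_localAlg (t : ℝ) (Λ : Set ℤ) {a : CAR} (ha : a ∈ localAlg Λ) :
    gauge t a ∈ localAlg Λ := by
  refine map_mem_cstarGen _ (gauge t) (map_continuous (gauge t)) ?_ ha
  rintro _ ⟨j, hj, rfl⟩
  rw [gauge_c]
  exact SMulMemClass.smul_mem _ (subset_cstarGen _ ⟨j, hj, rfl⟩)

lemma localAlg_empty : localAlg ∅ = ⊥ := by
  rw [localAlg, Set.image_empty, cstarGen_empty]

lemma localAlg_univ : localAlg Set.univ = ⊤ := by
  refine cstarGen_eq_top (s := Set.range annihilate)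
    ((cstarGen (Set.range annihilate)).subtype : CAR →⋆ₐ[ℂ] (Fock →L[ℂ] Fock))
    isometry_subtype_coe (fun a => a.2) ?_
  rintro _ ⟨j, rfl⟩
  exact ⟨c j, ⟨j, Set.mem_univ j, rfl⟩, rfl⟩

lemma exists_odd_involution {Λ : Set ℤ} (hΛ : Λ.Nonempty) :
    ∃ u ∈ localAlg Λ, u * u = 1 ∧ Θ u = -u := by
  obtain ⟨j, hj⟩ := hΛ
  have hc : c j ∈ localAlg Λ := subset_cstarGen _ ⟨j, hj, rfl⟩
  -- The square is `c_j c_j⋆ + c_j⋆ c_j = 1`, because `c_j² = 0`.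
  refine ⟨c j + star (c j), add_mem hc (star_mem hc), ?_, ?_⟩
  · have h1 : c j * c j = 0 := by
      have h := c_anticomm j j
      rw [← two_smul ℂ] at h
      exact (smul_eq_zero.mp h).resolve_left two_ne_zero
    have h2 : star (c j) * star (c j) = 0 := by rw [← star_mul, h1, star_zero]
    have h3 := c_anticomm_star j j
    rw [if_pos rfl] at h3
    rw [add_mul, mul_add, mul_add, h1, h2, zero_add, add_zero, h3]
  · rw [map_add, map_star, Θ_c, star_neg, neg_add]

lemma odd_or_trivial (Λ : Set ℤ) :
    (∃ u ∈ localAlg Λ, u * u = 1 ∧ Θ u = -u) ∨ localAlg Λ = ⊥ ∧ localAlg Λᶜ = ⊤ := by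
  rcases Λ.eq_empty_or_nonempty with rfl | hΛ
  · exact Or.inr ⟨localAlg_empty, by rw [Set.compl_empty, localAlg_univ]⟩
  · exact Or.inl (exists_odd_involution hΛ)

variable (ψ : CAR →ₚ[ℂ] ℂ) (h : ∀ a, ψ (Θ a) = ψ a)

lemma twistedRep_apply (a : CAR) : twistedRep ψ h a =
    twistOp ψ h * ψ.gnsStarAlgHom (gauge (-(Real.pi / 2)) a) * star (twistOp ψ h) := rfl

lemma twistOp_mul_star : twistOp ψ h * star (twistOp ψ h) = 1 := (twistUnitary ψ h).2.2

lemma star_mul_twistOp : star (twistOp ψ h) * twistOp ψ h = 1 := (twistUnitary ψ h).2.1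

lemma Γ_mul_twistOp : Γ ψ h * twistOp ψ h = twistOp ψ h * Γ ψ h := by
  rw [twistOp, mul_smul_comm, smul_mul_assoc, mul_add, add_mul, mul_smul_comm, smul_mul_assoc,
    mul_one, one_mul]

lemma Γ_mul_star_twistOp : Γ ψ h * star (twistOp ψ h) = star (twistOp ψ h) * Γ ψ h := by
  have := congrArg star (Γ_mul_twistOp ψ h)
  rw [star_mul, star_mul, star_Γ] at this
  exact this.symm

/-- The unitary `e^{iπΓ/4}` is a polynomial in `Γ`, so it commutes with even operators and the
conjugation drops out. -/
lemma twistedRep_even {a : CAR} (ha : Θ a = a) :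
    twistedRep ψ h a = ψ.gnsStarAlgHom (gauge (-(Real.pi / 2)) a) := by
  have hc := Γ_mul_gns ψ h (gauge (-(Real.pi / 2)) a)
  rw [Θ_gauge, ha] at hc
  have hc' : twistOp ψ h * ψ.gnsStarAlgHom (gauge (-(Real.pi / 2)) a) =
      ψ.gnsStarAlgHom (gauge (-(Real.pi / 2)) a) * twistOp ψ h := by
    rw [twistOp, mul_smul_comm, smul_mul_assoc, mul_add, add_mul, mul_smul_comm, smul_mul_assoc,
      mul_one, one_mul, hc]
  rw [twistedRep_apply, hc', mul_assoc, twistOp_mul_star, mul_one]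

/-- The remaining gauge rotation is invertible and preserves both locality and parity, so it
permutes the even elements of the local algebra. -/
lemma twistedRep_image_even (Λ : Set ℤ) :
    twistedRep ψ h '' evenElements Θ (localAlg Λ) =
      ψ.gnsStarAlgHom '' evenElements Θ (localAlg Λ) := by
  ext T
  constructor
  · rintro ⟨a, ha, rfl⟩
    refine ⟨gauge (-(Real.pi / 2)) a, ⟨gauge_mem_localAlg _ _ ha.1, ?_⟩, ?_⟩
    · rw [Θ_gauge, ha.2]
    · rw [twistedRep_even ψ h ha.2]
  · rintro ⟨a, ha, rfl⟩
    have he : Θ (gauge (-(-(Real.pi / 2))) a) = gauge (-(-(Real.pi / 2))) a := by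
      rw [Θ_gauge, ha.2]
    refine ⟨gauge (-(-(Real.pi / 2))) a, ⟨gauge_mem_localAlg _ _ ha.1, he⟩, ?_⟩
    rw [twistedRep_even ψ h he, gauge_neg_gauge]

lemma Γ_mul_twistedRep (a : CAR) :
    Γ ψ h * twistedRep ψ h a = twistedRep ψ h (Θ a) * Γ ψ h := by
  rw [twistedRep_apply, twistedRep_apply, ← mul_assoc, ← mul_assoc, Γ_mul_twistOp,
    mul_assoc (twistOp ψ h), Γ_mul_gns, Θ_gauge, mul_assoc _ _ (Γ ψ h), ← Γ_mul_star_twistOp]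
  simp only [mul_assoc]

lemma twistedRep_commutant (hψ : IsPureState ψ) :
    ∀ T ∈ (Set.range (twistedRep ψ h)).centralizer, ∃ z : ℂ, T = z • 1 := by
  intro T hT
  have hT' : star (twistOp ψ h) * T * twistOp ψ h ∈ (Set.range ψ.gnsStarAlgHom).centralizer := by
    rintro _ ⟨a, rfl⟩
    -- The test element is rotated back so that the gauge rotation inside `twistedRep` cancels.
    have h1 := hT _ ⟨gauge (-(-(Real.pi / 2))) a, rfl⟩
    rw [twistedRep_apply, gauge_neg_gauge] at h1
    have h2 := congrArg (fun R => star (twistOp ψ h) * R * twistOp ψ h) h1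
    have e1 (X Y Z : ψ.GNS →L[ℂ] ψ.GNS) :
        star (twistOp ψ h) * (twistOp ψ h * X * Y * Z) * twistOp ψ h =
          (star (twistOp ψ h) * twistOp ψ h) * X * (Y * Z * twistOp ψ h) := by
      simp only [mul_assoc]
    have e2 (X Y Z : ψ.GNS →L[ℂ] ψ.GNS) :
        star (twistOp ψ h) * (Z * (twistOp ψ h * X * Y)) * twistOp ψ h =
          star (twistOp ψ h) * Z * twistOp ψ h * X * (Y * twistOp ψ h) := by
      simp only [mul_assoc]
    simp only [e1, e2, star_mul_twistOp, one_mul, mul_one] at h2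
    exact h2
  obtain ⟨z, hz⟩ := gns_commutant_eq_scalar ψ hψ hT'
  refine ⟨z, ?_⟩
  have h3 := congrArg (fun R => twistOp ψ h * R * star (twistOp ψ h)) hz
  have e3 : twistOp ψ h * (star (twistOp ψ h) * T * twistOp ψ h) * star (twistOp ψ h) =
      (twistOp ψ h * star (twistOp ψ h)) * T * (twistOp ψ h * star (twistOp ψ h)) := by
    simp only [mul_assoc]
  simp only [e3, twistOp_mul_star, one_mul, mul_one, mul_smul_comm, smul_mul_assoc] at h3
  exact h3

/-- This is the purpose of the twist: moving `π(c_j)` past `π(c_k)Γ` with `j ≠ k` gives one sign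
from the anticommutation relations and one from `Γ`, and they cancel. -/
lemma gns_subset_centralizer_twistedRep (Λ : Set ℤ) :
    ψ.gnsStarAlgHom '' (localAlg Λ : Set CAR) ⊆
      (twistedRep ψ h '' (localAlg Λᶜ : Set CAR)).centralizer := by
  refine commute_cstarGen ψ.gnsStarAlgHom (twistedRep ψ h) ?_
  rintro _ ⟨j, hj, rfl⟩ _ ⟨k, hk, rfl⟩
  have hjk : j ≠ k := fun e => hk (e ▸ hj)
  have hΓ : Γ ψ h * ψ.gnsStarAlgHom (c j) = -(ψ.gnsStarAlgHom (c j) * Γ ψ h) := by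
    rw [Γ_mul_gns, Θ_c, map_neg, neg_mul]
  have h1 : c k * c j = -(c j * c k) := eq_neg_of_add_eq_zero_right (c_anticomm j k)
  have h2 : star (c k) * c j = -(c j * star (c k)) := by
    have := c_anticomm_star j k
    rw [if_neg hjk] at this
    exact eq_neg_of_add_eq_zero_right this
  constructor
  · rw [twistedRep_c, mul_assoc, hΓ, mul_neg, ← mul_assoc, ← map_mul, h1, map_neg, neg_mul, neg_neg,
      map_mul, mul_assoc]
  · rw [twistedRep_star_c, mul_assoc, ← map_mul, h2, map_neg, mul_neg, map_mul, ← mul_assoc, hΓ,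
      neg_mul, neg_neg, mul_assoc]

/-- Twisted Haag duality is equivalent to duality of the even parts. -/
theorem twistedHaagDuality_iff (hψ : IsPureState ψ) (Λ : Set ℤ) :
    TwistedHaagDuality ψ h Λ ↔ EvenHaagDuality ψ Λ := by
  refine gns_duality_iff hψ h Θ_Θ (fun b hb => gauge_mem_localAlg _ _ hb)
    (fun b hb => gauge_mem_localAlg _ _ hb) (twistedRep_image_even ψ h Λᶜ)
    (Γ_mul_twistedRep ψ h) (twistedRep_commutant ψ h hψ)
    (gns_subset_centralizer_twistedRep ψ h Λ) (odd_or_trivial Λ) ?_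
  have := odd_or_trivial Λᶜ
  rwa [compl_compl] at this

end CAR

/-! ### The spin algebra -/

namespace Spin

lemma Θ_Θ (a : Spin) : Θ (Θ a) = a :=
  Subtype.ext (gaugeConj_pi_pi _)

lemma Θ_site (j : ℤ) (Q : Matrix (Fin 2) (Fin 2) ℂ) :
    Θ (site j Q) = site j (Matrix.of fun a b => (if a = b then 1 else -1) * Q a b) :=
  Subtype.ext (gaugeConj_siteOp j Q)

lemma Θ_mem_localAlg (Λ : Set ℤ) {a : Spin} (ha : a ∈ localAlg Λ) : Θ a ∈ localAlg Λ := by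
  refine map_mem_cstarGen _ Θ (map_continuous Θ) ?_ ha
  rintro _ ⟨j, hj, Q, rfl⟩
  rw [Θ_site]
  exact subset_cstarGen _ ⟨j, hj, _, rfl⟩

lemma localAlg_empty : localAlg ∅ = ⊥ := by
  rw [localAlg, ← cstarGen_empty]
  congr 1
  ext x
  simp

lemma localAlg_univ : localAlg Set.univ = ⊤ := by
  refine cstarGen_eq_top (s := Set.range fun x : ℤ × Matrix (Fin 2) (Fin 2) ℂ => siteOp x.1 x.2)
    ((cstarGen (Set.range fun x : ℤ × Matrix (Fin 2) (Fin 2) ℂ => siteOp x.1 x.2)).subtype :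
      Spin →⋆ₐ[ℂ] (Fock →L[ℂ] Fock))
    isometry_subtype_coe (fun a => a.2) ?_
  rintro _ ⟨⟨j, Q⟩, rfl⟩
  exact ⟨site j Q, ⟨j, Set.mem_univ j, Q, rfl⟩, rfl⟩

lemma odd_or_trivial (Λ : Set ℤ) :
    (∃ u ∈ localAlg Λ, u * u = 1 ∧ Θ u = -u) ∨ localAlg Λ = ⊥ ∧ localAlg Λᶜ = ⊤ := by
  rcases Λ.eq_empty_or_nonempty with rfl | ⟨j, hj⟩
  · exact Or.inr ⟨localAlg_empty, by rw [Set.compl_empty, localAlg_univ]⟩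
  -- The odd involution is `σ_x` at a site of `Λ`.
  · refine Or.inl ⟨site j !![0, 1; 1, 0], subset_cstarGen _ ⟨j, hj, _, rfl⟩, ?_, (Θ_pauli j).1⟩
    rw [← site_mul, ← site_one j]
    congr 1
    simp [Matrix.one_fin_two]

variable (φ : Spin →ₚ[ℂ] ℂ)

lemma gns_subset_centralizer (Λ : Set ℤ) :
    φ.gnsStarAlgHom '' (localAlg Λ : Set Spin) ⊆
      (φ.gnsStarAlgHom '' (localAlg Λᶜ : Set Spin)).centralizer := by
  refine commute_cstarGen φ.gnsStarAlgHom φ.gnsStarAlgHom ?_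
  rintro _ ⟨j, hj, P, rfl⟩ _ ⟨k, hk, Q, rfl⟩
  have hkj : k ≠ j := fun e => hk (e ▸ hj)
  rw [← site_star, ← map_mul, ← map_mul, ← map_mul, ← map_mul, site_commute hkj, site_commute hkj]
  exact ⟨rfl, rfl⟩

/-- Haag duality is equivalent to duality of the even parts. -/
theorem haagDuality_iff (hφ : IsPureState φ) (h : ∀ a, φ (Θ a) = φ a) (Λ : Set ℤ) :
    HaagDuality φ Λ ↔ EvenHaagDuality φ Λ := by
  refine gns_duality_iff hφ h Θ_Θ (fun b hb => Θ_mem_localAlg _ hb)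
    (fun b hb => Θ_mem_localAlg _ hb) rfl (parityOp_mul_gns φ Θ h)
    (fun T hT => gns_commutant_eq_scalar φ hφ hT)
    (gns_subset_centralizer φ Λ) (odd_or_trivial Λ) ?_
  have := odd_or_trivial Λᶜ
  rwa [compl_compl] at this

end Spin

end TwistedDuality

end

theorem mainTheorem8 :
    (∀ (ψ : TwistedDuality.CAR →ₚ[ℂ] ℂ), TwistedDuality.IsPureState ψ →
      ∀ (hΘ : ∀ a, ψ (TwistedDuality.CAR.Θ a) = ψ a) (Λ : Set ℤ),
        TwistedDuality.CAR.TwistedHaagDuality ψ hΘ Λ ↔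
          TwistedDuality.CAR.EvenHaagDuality ψ Λ) ∧
    (∀ (φ : TwistedDuality.Spin →ₚ[ℂ] ℂ), TwistedDuality.IsPureState φ →
      (∀ a, φ (TwistedDuality.Spin.Θ a) = φ a) → ∀ (Λ : Set ℤ),
        TwistedDuality.Spin.HaagDuality φ Λ ↔
          TwistedDuality.Spin.EvenHaagDuality φ Λ) := by
  exact ⟨fun ψ hψ hΘ Λ => TwistedDuality.CAR.twistedHaagDuality_iff ψ hΘ hψ Λ,
    fun φ hφ hΘ Λ => TwistedDuality.Spin.haagDuality_iff φ hφ hΘ Λ⟩
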